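/- Let $\hbar,m_0,\omega,a>0$ and $\lambda_0=\sqrt{m_0\omega/\hbar}$. Put $M(x)=\dfrac{a^2m_0}{(a+x)^2}$ and let $V(x)=\tfrac12M(x)\omega^2x^2$ for $x>-a$ and $V(x)=+\infty$ (an infinitely high wall) for $x\le -a$. A \emph{bound state} of energy $E\in\mathbb R$ is a continuous, square-integrable function $\psi:\mathbb R\to\mathbb C$, not identically zero, with $\psi(x)=0$ for $x\le -a$, such that on $(-a,\infty)$ both $\psi$ and $\frac1M\psi'$ are differentiable and the BenDaniel--Duke Schrödinger equation $$\frac{\hbar^2}{2}\frac{d}{dx}\Big(\frac1{M}\frac{d\psi}{dx}\Big)+(E-V)\psi=0$$ holds. For $n\in\mathbb N_0$ with $n<\lambda_0^2a^2-\tfrac12$ put $$E_n=\hbar\omega\Big(n+\frac12\Big)-\frac{\hbar^2}{2m_0a^2}\,n(n+1),$$ $$\psi_n(x)=C_n\Big(\frac xa+1\Big)^{-\lambda_0^2a^2}e^{-\frac{\lambda_0^2a^3}{x+a}}\;y_n\Big(\frac{x+a}{\lambda_0^2a^3};-2\lambda_0^2a^2\Big)\quad(x>-a),\qquad \psi_n(x)=0\quad(x\le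 -a),$$ $$C_n=(2\lambda_0^2a^2)^{\lambda_0^2a^2}\sqrt{\frac{2\lambda_0^2a^2-2n-1}{2\lambda_0^2a^3\,n!\,\Gamma(2\lambda_0^2a^2-n)}},$$ where $y_n(x;\alpha)={}_2F_0(-n,n+\alpha+1;-;-x/2)=\sum_{k=0}^n\frac{(-n)_k(n+\alpha+1)_k}{k!}\big(-\tfrac x2\big)^k$ is the Bessel polynomial. Then: 1. A function $\psi$ is a bound state of energy $E$ if and only if there are an integer $n$ with $0\le n<\lambda_0^2a^2-\tfrac12$ and a constant $c\in\mathbb C\setminus\{0\}$ such that $E=E_n$ and $\psi=c\,\psi_n$. 2. The functions $\psi_n$, $0\le n<\lambda_0^2a^2-\tfrac12$, are orthonormal: $\int_{-\infty}^{\infty}\psi_m\psi_n\,dx=\delta_{mn}$ (the products being integrable). 3. $E_n$ is strictly increasing in $n$ on $0\le n<\lambda_0^2a^2-\tfrac12$. 4. Consequently there are only finitely many bound-state energies: if $\lambda_0^2a^2>\tfrac12$ and $N$ is the largest integer with $N<\lambda_0^2a^2-\tfrac12$, they are exactly $E_0,E_1,\dots,E_N$; if $\lambda_0^2a^2\le\tfrac12$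 there is no bound state. -/

import Mathlib

open MeasureTheory Set

noncomputable section

/-- `ψ` is a bound state of energy `E` of the BenDaniel–Duke Hamiltonian
`-(ħ²/2) (d/dx) (1/M) (d/dx) + V` on the line, where the potential may take the value `⊤` (an
infinitely high wall): `ψ` is continuous, vanishes inside the walls, solves the Schrödinger equation
in the classical sense outside of them, is square integrable, and is not identically zero.
Continuity forces `ψ` to tend to `0` at a wall. -/
structure IsBoundState (ħ : ℝ) (M : ℝ → ℝ) (V : ℝ → EReal) (E : ℝ) (ψ : ℝ → ℂ) : Prop where
  continuous : Continuous ψ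
  eq_zero_of_wall : ∀ x, V x = ⊤ → ψ x = 0
  differentiableAt : ∀ x, V x ≠ ⊤ → DifferentiableAt ℝ ψ x
  differentiableAt_flux : ∀ x, V x ≠ ⊤ →
    DifferentiableAt ℝ (fun y => ((1 / M y : ℝ) : ℂ) * deriv ψ y) x
  schrodinger : ∀ x, V x ≠ ⊤ →
    ((ħ ^ 2 / 2 : ℝ) : ℂ) * deriv (fun y => ((1 / M y : ℝ) : ℂ) * deriv ψ y) x
      + ((E - (V x).toReal : ℝ) : ℂ) * ψ x = 0
  memLp : MemLp ψ 2 volume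
  ne_zero : ψ ≠ 0

/-- The set of energies of the bound states. -/
def boundEnergies (ħ : ℝ) (M : ℝ → ℝ) (V : ℝ → EReal) : Set ℝ :=
  {E | ∃ ψ : ℝ → ℂ, IsBoundState ħ M V E ψ}

/-- The position-dependent mass `M(x) = a² m₀ / (a + x)²`. -/
def mass (m₀ a : ℝ) (x : ℝ) : ℝ := a ^ 2 * m₀ / (a + x) ^ 2

/-- The potential `M(x) ω² x² / 2` for `x > -a`, with an infinitely high wall at `x ≤ -a`. -/
def wellPotential (m₀ ω a : ℝ) (x : ℝ) : EReal :=
  if -a < x then ((mass m₀ a x * ω ^ 2 * x ^ 2 / 2 : ℝ) : EReal) else ⊤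

/-- `λ₀ = √(m₀ ω / ħ)`. -/
def lam₀ (ħ m₀ ω : ℝ) : ℝ := √(m₀ * ω / ħ)

/-- The Bessel polynomial `y_n(x; α) = ₂F₀(-n, n + α + 1; -; -x/2)`. -/
def besselPoly (n : ℕ) (α x : ℝ) : ℝ :=
  ∑ k ∈ Finset.range (n + 1),
    (ascPochhammer ℝ k).eval (-(n : ℝ)) * (ascPochhammer ℝ k).eval ((n : ℝ) + α + 1)
      / (k.factorial : ℝ) * (-x / 2) ^ k

/-- `E_n = ħ ω (n + 1/2) - ħ² n (n + 1) / (2 m₀ a²)`. -/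
def energyLevel (ħ m₀ ω a : ℝ) (n : ℕ) : ℝ :=
  ħ * ω * ((n : ℝ) + 1 / 2) - ħ ^ 2 / (2 * m₀ * a ^ 2) * ((n : ℝ) * ((n : ℝ) + 1))

/-- The normalization constant
`C_n = (2λ₀²a²)^(λ₀²a²) √((2λ₀²a² - 2n - 1) / (2λ₀²a³ n! Γ(2λ₀²a² - n)))`. -/
def normConst (ħ m₀ ω a : ℝ) (n : ℕ) : ℝ :=
  (2 * lam₀ ħ m₀ ω ^ 2 * a ^ 2) ^ (lam₀ ħ m₀ ω ^ 2 * a ^ 2) *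
    √((2 * lam₀ ħ m₀ ω ^ 2 * a ^ 2 - 2 * (n : ℝ) - 1) /
      (2 * lam₀ ħ m₀ ω ^ 2 * a ^ 3 * (n.factorial : ℝ) *
        Real.Gamma (2 * lam₀ ħ m₀ ω ^ 2 * a ^ 2 - n)))

/-- `ψ_n(x) = C_n (x/a + 1)^(-λ₀²a²) exp(-λ₀²a³/(x + a)) y_n((x + a)/(λ₀²a³); -2λ₀²a²)` for
`x > -a`, extended by `0` into the wall. -/
def waveFun (ħ m₀ ω a : ℝ) (n : ℕ) (x : ℝ) : ℝ :=
  if -a < x then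
    normConst ħ m₀ ω a n * (x / a + 1) ^ (-(lam₀ ħ m₀ ω ^ 2 * a ^ 2)) *
      Real.exp (-(lam₀ ħ m₀ ω ^ 2 * a ^ 3 / (x + a))) *
      besselPoly n (-(2 * lam₀ ħ m₀ ω ^ 2 * a ^ 2)) ((x + a) / (lam₀ ħ m₀ ω ^ 2 * a ^ 3))
  else 0

end

/-!
Put `Λ = λ₀² a²` and pass to the logarithmic variable, `x = a e^t - a` and `v(t) = e^{t/2} ψ(x)`. The
Schrödinger equation becomes the Morse equation
`v'' = (N - 2Bγ e^{-t} + B² e^{-2t}) v` with `B = γ = Λ` and `N = Λ² + 1/4 - 2 a² m₀ E / ħ²`, and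
`∫ ψ² dx` becomes `a ∫ v² dt` (`hasDerivAt_morse_of_flux`, `hasDerivAt_flux_of_morse`,
`integral_comp_mul_exp_sub`).

A bound state gives a solution that tends to `0` at `-∞` and is square integrable at `+∞`. Convexity
of `v²` near `-∞` then forces decay faster than every power of `e^t`, and near `+∞` both `v` and `v'`
are square integrable, hence tend to `0` (`isMorseState_of_integrableOn`). This class of solutions,
`IsMorseState`, is preserved by the ladder operator `v ↦ v' + W v`, `W = γ - 1/2 - B e^{-t}`, which
replaces `γ` by `γ - 1` and keeps `N` (`IsMorseState.lower`). For `γ ≤ 0` and `N ≥ 0` the class is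
zero, because `v²` is convex and decays at both ends; for `N < 0` it is zero, because an energy is
essentially monotone. The kernel of the ladder operator is spanned by the ground state
`exp (-(γ - 1/2) t - B e^{-t})`, which decays only if `γ > 1/2`. Induction on `γ` therefore yields
`N = (γ - 1/2 - n)²` with `n < γ - 1/2`, and determines `v` up to a factor
(`IsMorseState.eq_zero_or_eq_morseFun`). No uniqueness theorem for the differential equation is
needed: `v` is recovered from its image under the ladder operator by the raising relation.

The eigenfunctions are explicit, a weight times a Bessel polynomial. Lowering is the formula for the
derivative of a Bessel polynomial (`hasDerivAt_besselPoly_succ`), raising is `besselPoly_raise`; both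
are identities between coefficients. Integrating by parts along the ladder
(`integral_morseFun_mul_succ`) gives the orthogonality relations and reduces the norms to that of the
ground state, a Gamma integral.
-/

/-! ### Bessel polynomials -/

/-- The coefficient of `x ^ k` in the Bessel polynomial `y_n(x; α)`. -/
noncomputable def besselCoeff (n : ℕ) (α : ℝ) (k : ℕ) : ℝ :=
  (ascPochhammer ℝ k).eval (-(n : ℝ)) * (ascPochhammer ℝ k).eval ((n : ℝ) + α + 1)
    / (k.factorial : ℝ) * (-1 / 2) ^ k

theorem besselPoly_eq_sum (n : ℕ) (α x : ℝ) :
    besselPoly n α x = ∑ k ∈ Finset.range (n + 1), besselCoeff n α k * x ^ k := by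
  unfold besselPoly besselCoeff
  refine Finset.sum_congr rfl fun k _ => ?_
  rw [show -x / 2 = (-1 / 2) * x by ring, mul_pow]
  ring

theorem besselPoly_zero (α x : ℝ) : besselPoly 0 α x = 1 := by
  simp [besselPoly]

theorem ascPochhammer_eval_succ_left (k : ℕ) (x : ℝ) :
    (ascPochhammer ℝ (k + 1)).eval x = x * (ascPochhammer ℝ k).eval (x + 1) := by
  simp [ascPochhammer_succ_left]

theorem besselCoeff_zero (n : ℕ) (α : ℝ) : besselCoeff n α 0 = 1 := by
  simp [besselCoeff]

theorem besselCoeff_self_add_one (n : ℕ) (α : ℝ) : besselCoeff n α (n + 1) = 0 := by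
  simp [besselCoeff, ascPochhammer_eval_neg_coe_nat_of_lt (R := ℝ) (Nat.lt_succ_self n)]

theorem besselCoeff_succ_succ (n : ℕ) (α : ℝ) (k : ℕ) :
    besselCoeff (n + 1) α (k + 1) * (k + 1) =
      (n + 1) * (n + α + 2) / 2 * besselCoeff n (α + 2) k := by
  unfold besselCoeff
  rw [ascPochhammer_eval_succ_left, ascPochhammer_eval_succ_left, Nat.factorial_succ]
  push_cast
  rw [show -((n : ℝ) + 1) + 1 = -n by ring,
    show (n : ℝ) + 1 + α + 1 + 1 = n + (α + 2) + 1 by ring]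
  have h1 : (k : ℝ) + 1 ≠ 0 := by positivity
  have h2 : (k.factorial : ℝ) ≠ 0 := by positivity
  field_simp
  ring

theorem besselCoeff_raise (n : ℕ) (α : ℝ) (k : ℕ) :
    besselCoeff (n + 1) α (k + 1) =
      besselCoeff n (α + 2) (k + 1) + (α + 2 + k) / 2 * besselCoeff n (α + 2) k := by
  unfold besselCoeff
  rw [ascPochhammer_eval_succ_left, ascPochhammer_eval_succ_left, Nat.factorial_succ,
    ascPochhammer_succ_eval, ascPochhammer_succ_eval]
  push_cast
  rw [show -((n : ℝ) + 1) + 1 = -n by ring,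
    show (n : ℝ) + 1 + α + 1 + 1 = n + (α + 2) + 1 by ring]
  have h1 : (k : ℝ) + 1 ≠ 0 := by positivity
  have h2 : (k.factorial : ℝ) ≠ 0 := by positivity
  field_simp
  ring

/-- Differentiation lowers the degree of a Bessel polynomial and raises its parameter by two. -/
theorem hasDerivAt_besselPoly_succ (n : ℕ) (α x : ℝ) :
    HasDerivAt (besselPoly (n + 1) α)
      ((n + 1) * (n + α + 2) / 2 * besselPoly n (α + 2) x) x := by
  have h : HasDerivAt (fun x => ∑ k ∈ Finset.range (n + 2), besselCoeff (n + 1) α k * x ^ k)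
      (∑ k ∈ Finset.range (n + 2), besselCoeff (n + 1) α k * (k * x ^ (k - 1))) x :=
    HasDerivAt.fun_sum fun k _ => (hasDerivAt_pow k x).const_mul _
  have e : besselPoly (n + 1) α =
      fun x => ∑ k ∈ Finset.range (n + 2), besselCoeff (n + 1) α k * x ^ k := by
    funext y; exact besselPoly_eq_sum _ _ _
  rw [e]
  refine h.congr_deriv ?_
  rw [Finset.sum_range_succ', besselPoly_eq_sum, Finset.mul_sum]
  simp only [Nat.cast_zero, zero_mul, mul_zero, add_zero]
  refine Finset.sum_congr rfl fun k _ => ?_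
  rw [← mul_assoc _ _ (x ^ k), ← besselCoeff_succ_succ]
  push_cast
  ring

/-- The raising relation of the Bessel polynomials. Together with `hasDerivAt_besselPoly_succ` it is
equivalent to their differential equation. -/
theorem besselPoly_raise (n : ℕ) (α x : ℝ) :
    besselPoly (n + 1) α x =
      (1 + (α + 2) * x / 2) * besselPoly n (α + 2) x
        + x ^ 2 / 2 * deriv (besselPoly n (α + 2)) x := by
  have h : HasDerivAt (besselPoly n (α + 2))
      (∑ k ∈ Finset.range (n + 1), besselCoeff n (α + 2) k * (k * x ^ (k - 1))) x := by
    have e : besselPoly n (α + 2) =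
        fun x => ∑ k ∈ Finset.range (n + 1), besselCoeff n (α + 2) k * x ^ k := by
      funext y; exact besselPoly_eq_sum _ _ _
    rw [e]
    exact HasDerivAt.fun_sum fun k _ => (hasDerivAt_pow k x).const_mul _
  have h2 : besselPoly n (α + 2) x =
      ∑ k ∈ Finset.range (n + 1), besselCoeff n (α + 2) (k + 1) * x ^ (k + 1) + 1 := by
    rw [besselPoly_eq_sum, ← add_zero (Finset.sum _ _),
      ← zero_mul (x ^ (n + 1)), ← besselCoeff_self_add_one n (α + 2),
      ← Finset.sum_range_succ, Finset.sum_range_succ', besselCoeff_zero]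
    simp
  rw [h.deriv, besselPoly_eq_sum (n + 1), Finset.sum_range_succ', besselCoeff_zero,
    add_mul 1 _ (besselPoly _ _ _), one_mul (besselPoly _ _ _)]
  nth_rw 1 [h2]
  rw [besselPoly_eq_sum, Finset.mul_sum, Finset.mul_sum, pow_zero, mul_one]
  have key : ∀ p q r s : ℝ, p = q + r + s → p + 1 = q + 1 + r + s := fun p q r s h => by
    rw [h]; ring
  apply key
  rw [← Finset.sum_add_distrib, ← Finset.sum_add_distrib]
  refine Finset.sum_congr rfl fun k _ => ?_
  rw [besselCoeff_raise]
  rcases k with _ | k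
  · simp; ring
  · push_cast
    ring

theorem differentiable_besselPoly (n : ℕ) (α : ℝ) : Differentiable ℝ (besselPoly n α) := by
  intro x
  rcases n with _ | n
  · simp only [funext (besselPoly_zero α)]
    exact differentiableAt_const _
  · exact (hasDerivAt_besselPoly_succ n α x).differentiableAt

/-! ### Morse eigenfunctions and the ladder relations -/

/-- The superpotential `W = γ - 1/2 - B e^{-t}` of the Morse oscillator. -/
noncomputable def superpotential (B γ t : ℝ) : ℝ := γ - 1 / 2 - B * Real.exp (-t)

/-- The weight `exp (-δ t - β e^{-t})`. It satisfies `g' = -W g` for `δ = γ - 1/2`, `β = B`. -/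
noncomputable def morseWeight (β δ t : ℝ) : ℝ := Real.exp (-δ * t - β * Real.exp (-t))

/-- The `n`-th (unnormalized) eigenfunction of the Morse oscillator with parameters `B`, `γ`. -/
noncomputable def morseFun (B γ : ℝ) (n : ℕ) (t : ℝ) : ℝ :=
  morseWeight B (γ - 1 / 2) t * besselPoly n (-(2 * γ)) (Real.exp t / B)

theorem hasDerivAt_exp_neg (t : ℝ) :
    HasDerivAt (fun t => Real.exp (-t)) (-Real.exp (-t)) t := by
  simpa using (hasDerivAt_neg t).exp

theorem hasDerivAt_superpotential (B γ t : ℝ) :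
    HasDerivAt (superpotential B γ) (B * Real.exp (-t)) t := by
  have := ((hasDerivAt_exp_neg t).const_mul B).const_sub (γ - 1 / 2)
  exact this.congr_deriv (by ring)

theorem hasDerivAt_morseWeight (β δ t : ℝ) :
    HasDerivAt (morseWeight β δ) (-(δ - β * Real.exp (-t)) * morseWeight β δ t) t := by
  have := (((hasDerivAt_id t).const_mul (-δ)).sub ((hasDerivAt_exp_neg t).const_mul β)).exp
  exact this.congr_deriv (by simp [morseWeight]; ring)

theorem morseWeight_pos (β δ t : ℝ) : 0 < morseWeight β δ t := Real.exp_pos _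

theorem morseWeight_mul_exp (β δ t : ℝ) :
    morseWeight β δ t * Real.exp t = morseWeight β (δ - 1) t := by
  unfold morseWeight; rw [← Real.exp_add]; congr 1; ring

theorem morseWeight_mul_exp_pow (β δ t : ℝ) (k : ℕ) :
    morseWeight β δ t * Real.exp t ^ k = morseWeight β (δ - k) t := by
  unfold morseWeight; rw [← Real.exp_nat_mul, ← Real.exp_add]; congr 1; ring

theorem exp_neg_pow_mul_morseWeight (β δ t : ℝ) (p : ℕ) :
    Real.exp (-t) ^ p * morseWeight β δ t = morseWeight β (δ + p) t := by
  unfold morseWeight; rw [← Real.exp_nat_mul, ← Real.exp_add]; congr 1; ring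

theorem tendsto_exp_neg_atBot :
    Filter.Tendsto (fun t : ℝ => Real.exp (-t)) Filter.atBot Filter.atTop :=
  Real.tendsto_exp_atTop.comp Filter.tendsto_neg_atBot_atTop

theorem tendsto_exp_neg_atTop :
    Filter.Tendsto (fun t : ℝ => Real.exp (-t)) Filter.atTop (nhds 0) :=
  Real.tendsto_exp_neg_atTop_nhds_zero

theorem tendsto_morseWeight_atTop {β δ : ℝ} (hδ : 0 < δ) :
    Filter.Tendsto (morseWeight β δ) Filter.atTop (nhds 0) := by
  refine Real.tendsto_exp_atBot.comp ?_
  simp only [sub_eq_add_neg]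
  refine Filter.Tendsto.atBot_add (C := -(β * 0)) ?_ (tendsto_exp_neg_atTop.const_mul β).neg
  exact Filter.Tendsto.const_mul_atTop_of_neg (by linarith) Filter.tendsto_id

theorem tendsto_morseWeight_atBot {β : ℝ} (hβ : 0 < β) (δ : ℝ) :
    Filter.Tendsto (morseWeight β δ) Filter.atBot (nhds 0) := by
  have := (tendsto_rpow_mul_exp_neg_mul_atTop_nhds_zero δ β hβ).comp tendsto_exp_neg_atBot
  refine this.congr fun t => ?_
  simp only [Function.comp, morseWeight]
  rw [← Real.exp_mul, ← Real.exp_add]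
  congr 1; ring

/-- The lowering relation of the Morse eigenfunctions. -/
theorem hasDerivAt_morseFun_succ {B : ℝ} (hB : B ≠ 0) (γ : ℝ) (n : ℕ) (t : ℝ) :
    HasDerivAt (morseFun B γ (n + 1))
      (-superpotential B γ t * morseFun B γ (n + 1) t +
        (n + 1) * (n + 2 - 2 * γ) / (2 * B) * morseFun B (γ - 1) n t) t := by
  have h1 := (hasDerivAt_besselPoly_succ n (-(2 * γ)) (Real.exp t / B)).comp t
    ((Real.hasDerivAt_exp t).div_const B)
  refine ((hasDerivAt_morseWeight B (γ - 1 / 2) t).mul h1).congr_deriv ?_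
  simp only [morseFun, superpotential, Function.comp]
  rw [show γ - 1 - 1 / 2 = γ - 1 / 2 - 1 by ring, ← morseWeight_mul_exp,
    show -(2 * (γ - 1)) = -(2 * γ) + 2 by ring]
  field_simp
  ring

theorem hasDerivAt_morseFun_zero (B γ t : ℝ) :
    HasDerivAt (morseFun B γ 0) (-superpotential B γ t * morseFun B γ 0 t) t := by
  have e : morseFun B γ 0 = morseWeight B (γ - 1 / 2) := by
    funext t; simp [morseFun, besselPoly_zero]
  rw [e]
  exact hasDerivAt_morseWeight B (γ - 1 / 2) t

/-- The raising relation of the Morse eigenfunctions. -/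
theorem hasDerivAt_morseFun_raise {B : ℝ} (hB : B ≠ 0) (γ : ℝ) (n : ℕ) (t : ℝ) :
    HasDerivAt (morseFun B (γ - 1) n)
      (superpotential B γ t * morseFun B (γ - 1) n t + 2 * B * morseFun B γ (n + 1) t) t := by
  have h1 := (differentiable_besselPoly n (-(2 * (γ - 1))) (Real.exp t / B)).hasDerivAt.comp t
    ((Real.hasDerivAt_exp t).div_const B)
  refine ((hasDerivAt_morseWeight B (γ - 1 - 1 / 2) t).mul h1).congr_deriv ?_
  simp only [morseFun, superpotential, Function.comp]
  rw [besselPoly_raise, show γ - 1 - 1 / 2 = γ - 1 / 2 - 1 by ring, ← morseWeight_mul_exp,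
    show -(2 * (γ - 1)) = -(2 * γ) + 2 by ring]
  have : Real.exp (-t) = 1 / Real.exp t := by rw [Real.exp_neg, one_div]
  have h3 := (Real.exp_pos t).ne'
  rw [this]
  field_simp
  ring

/-- The derivative of `morseFun B γ n`. For `n = 0` the truncated subtraction is harmless, as the
coefficient of the second summand vanishes. -/
noncomputable def morseFunDeriv (B γ : ℝ) (n : ℕ) (t : ℝ) : ℝ :=
  -superpotential B γ t * morseFun B γ n t +
    n * (n + 1 - 2 * γ) / (2 * B) * morseFun B (γ - 1) (n - 1) t

theorem hasDerivAt_morseFun {B : ℝ} (hB : B ≠ 0) (γ : ℝ) (n : ℕ) (t : ℝ) :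
    HasDerivAt (morseFun B γ n) (morseFunDeriv B γ n t) t := by
  rcases n with _ | n
  · exact (hasDerivAt_morseFun_zero B γ t).congr_deriv (by simp [morseFunDeriv])
  · refine (hasDerivAt_morseFun_succ hB γ n t).congr_deriv ?_
    simp only [morseFunDeriv, Nat.add_sub_cancel]
    push_cast
    ring

theorem hasDerivAt_morseFunDeriv {B : ℝ} (hB : B ≠ 0) (γ : ℝ) (n : ℕ) (t : ℝ) :
    HasDerivAt (morseFunDeriv B γ n)
      (((γ - 1 / 2 - n) ^ 2 - 2 * B * γ * Real.exp (-t) + (B * Real.exp (-t)) ^ 2)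
        * morseFun B γ n t) t := by
  have h1 := (hasDerivAt_superpotential B γ t).neg.mul (hasDerivAt_morseFun hB γ n t)
  have h2 : HasDerivAt (fun t => n * (n + 1 - 2 * γ) / (2 * B) * morseFun B (γ - 1) (n - 1) t)
      (n * (n + 1 - 2 * γ) / (2 * B) * (superpotential B γ t * morseFun B (γ - 1) (n - 1) t
        + 2 * B * morseFun B γ n t)) t := by
    rcases n with _ | n
    · simpa using hasDerivAt_const t (0 : ℝ)
    · exact (hasDerivAt_morseFun_raise hB γ n t).const_mul _
  refine (h1.add h2).congr_deriv ?_
  simp only [morseFunDeriv, superpotential, Pi.neg_apply]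
  field_simp
  ring

theorem morseFun_eq_sum (B γ : ℝ) (n : ℕ) (t : ℝ) :
    morseFun B γ n t = ∑ k ∈ Finset.range (n + 1),
      besselCoeff n (-(2 * γ)) k / B ^ k * morseWeight B (γ - 1 / 2 - k) t := by
  rw [morseFun, besselPoly_eq_sum, Finset.mul_sum]
  refine Finset.sum_congr rfl fun k _ => ?_
  rw [← morseWeight_mul_exp_pow, div_pow]
  ring

theorem tendsto_morseFun_atTop {B γ : ℝ} {n : ℕ} (hn : n < γ - 1 / 2) :
    Filter.Tendsto (morseFun B γ n) Filter.atTop (nhds 0) := by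
  have h0 : (0 : ℝ) = ∑ _k ∈ Finset.range (n + 1), 0 := by simp
  rw [funext (morseFun_eq_sum B γ n), h0]
  refine tendsto_finsetSum _ fun k hk => ?_
  have hk' : (k : ℝ) ≤ n := by exact_mod_cast Nat.lt_succ_iff.1 (Finset.mem_range.1 hk)
  simpa using (tendsto_morseWeight_atTop (β := B) (by linarith : 0 < γ - 1 / 2 - k)).const_mul
    (besselCoeff n (-(2 * γ)) k / B ^ k)

theorem tendsto_morseFun_atBot {B : ℝ} (hB : 0 < B) (γ : ℝ) (n p : ℕ) :
    Filter.Tendsto (fun t => Real.exp (-t) ^ p * morseFun B γ n t) Filter.atBot (nhds 0) := by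
  simp only [morseFun_eq_sum, Finset.mul_sum]
  have h0 : (0 : ℝ) = ∑ _k ∈ Finset.range (n + 1), 0 := by simp
  rw [h0]
  refine tendsto_finsetSum _ fun k _ => ?_
  have := (tendsto_morseWeight_atBot hB (γ - 1 / 2 - k + p)).const_mul
    (besselCoeff n (-(2 * γ)) k / B ^ k)
  rw [mul_zero] at this
  refine this.congr fun t => ?_
  rw [← exp_neg_pow_mul_morseWeight]
  ring

/-! ### Classification of Morse states -/

/-- `v`, with derivative `v₁`, solves the Morse equation
`v'' = (N - 2Bγ e^{-t} + B² e^{-2t}) v` on the line; `v` and `v'` tend to `0` at `+∞`, and at `-∞`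
they do so faster than any power of `e^t`. -/
structure IsMorseState (B γ N : ℝ) (v v₁ : ℝ → ℝ) : Prop where
  hasDerivAt : ∀ t, HasDerivAt v (v₁ t) t
  hasDerivAt₁ : ∀ t, HasDerivAt v₁
    ((N - 2 * B * γ * Real.exp (-t) + (B * Real.exp (-t)) ^ 2) * v t) t
  top : Filter.Tendsto v Filter.atTop (nhds 0)
  top₁ : Filter.Tendsto v₁ Filter.atTop (nhds 0)
  bot : ∀ p : ℕ, Filter.Tendsto (fun t => Real.exp (-t) ^ p * v t) Filter.atBot (nhds 0)
  bot₁ : ∀ p : ℕ, Filter.Tendsto (fun t => Real.exp (-t) ^ p * v₁ t) Filter.atBot (nhds 0)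

namespace IsMorseState

variable {B γ N : ℝ} {v v₁ : ℝ → ℝ}

/-- The ladder operator `v ↦ v' + W v` maps Morse states with parameter `γ` to Morse states with
parameter `γ - 1` and the same `N`. -/
theorem lower (h : IsMorseState B γ N v v₁) :
    IsMorseState B (γ - 1) N (fun t => v₁ t + superpotential B γ t * v t)
      (fun t => superpotential B γ t * (v₁ t + superpotential B γ t * v t)
        + (N - (γ - 1 / 2) ^ 2) * v t) := by
  have hbot : ∀ p : ℕ, Filter.Tendsto
      (fun t => Real.exp (-t) ^ p * (v₁ t + superpotential B γ t * v t))
      Filter.atBot (nhds 0) := fun p => by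
    have := ((h.bot₁ p).add ((h.bot p).const_mul (γ - 1 / 2))).sub ((h.bot (p + 1)).const_mul B)
    simp only [mul_zero, add_zero, sub_zero] at this
    refine this.congr fun t => ?_
    simp only [superpotential, pow_succ]
    ring
  have hW : Filter.Tendsto (superpotential B γ) Filter.atTop (nhds (γ - 1 / 2 - B * 0)) :=
    (tendsto_exp_neg_atTop.const_mul B).const_sub _
  have htop : Filter.Tendsto (fun t => v₁ t + superpotential B γ t * v t)
      Filter.atTop (nhds 0) := by
    simpa using h.top₁.add (hW.mul h.top)
  refine ⟨fun t => ?_, fun t => ?_, htop, ?_, hbot, fun p => ?_⟩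
  · refine ((h.hasDerivAt₁ t).add
      ((hasDerivAt_superpotential B γ t).mul (h.hasDerivAt t))).congr_deriv ?_
    simp only [superpotential]
    ring
  · have h1 := (h.hasDerivAt₁ t).add ((hasDerivAt_superpotential B γ t).mul (h.hasDerivAt t))
    refine (((hasDerivAt_superpotential B γ t).mul h1).add
      ((h.hasDerivAt t).const_mul (N - (γ - 1 / 2) ^ 2))).congr_deriv ?_
    simp only [superpotential, Pi.add_apply, Pi.mul_apply]
    ring
  · have := (hW.mul htop).add (h.top.const_mul (N - (γ - 1 / 2) ^ 2))
    simpa only [mul_zero, add_zero] using this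
  · have := (((hbot p).const_mul (γ - 1 / 2)).sub ((hbot (p + 1)).const_mul B)).add
      ((h.bot p).const_mul (N - (γ - 1 / 2) ^ 2))
    simp only [mul_zero, add_zero, sub_zero] at this
    refine this.congr fun t => ?_
    simp only [superpotential, pow_succ]
    ring

/-- For `γ ≤ 0` the Morse potential is repulsive, so `v²` is convex. As it decays at both ends, it
vanishes. -/
theorem eq_zero_of_nonpos (h : IsMorseState B γ N v v₁) (hB : 0 ≤ B) (hγ : γ ≤ 0) (hN : 0 ≤ N) :
    v = 0 := by
  have hmono : Monotone fun t => v t * v₁ t := by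
    refine monotone_of_hasDerivAt_nonneg
      (fun t => (h.hasDerivAt t).mul (h.hasDerivAt₁ t)) fun t => ?_
    have h1 := Real.exp_pos (-t)
    have h2 : 0 ≤ B * -γ * Real.exp (-t) := by
      have : 0 ≤ -γ := by linarith
      positivity
    have h3 : 0 ≤ N - 2 * B * γ * Real.exp (-t) + (B * Real.exp (-t)) ^ 2 := by
      nlinarith [sq_nonneg (B * Real.exp (-t))]
    have h4 : 0 ≤ (N - 2 * B * γ * Real.exp (-t) + (B * Real.exp (-t)) ^ 2) * v t ^ 2 := by
      positivity
    simp only [Pi.zero_apply]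
    nlinarith [sq_nonneg (v₁ t)]
  have htop : Filter.Tendsto (fun t => v t * v₁ t) Filter.atTop (nhds 0) := by
    simpa using h.top.mul h.top₁
  have hbot : Filter.Tendsto (fun t => v t * v₁ t) Filter.atBot (nhds 0) := by
    simpa using (h.bot 0).mul (h.bot₁ 0)
  have hz : ∀ t, v t * v₁ t = 0 := fun t =>
    le_antisymm (hmono.ge_of_tendsto htop t) (hmono.le_of_tendsto hbot t)
  have hc : ∀ s t, v s ^ 2 = v t ^ 2 := by
    refine is_const_of_deriv_eq_zero (f := fun t => v t ^ 2)
      (fun t => ((h.hasDerivAt t).pow 2).differentiableAt) fun t => ?_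
    have := ((h.hasDerivAt t).pow 2).deriv
    have e : (fun t => v t ^ 2) = v ^ 2 := rfl
    rw [e, this]
    have := hz t
    simp only [Nat.cast_ofNat, Nat.add_one_sub_one, pow_one]
    linear_combination 2 * this
  funext t
  have h1 : Filter.Tendsto (fun s => v s ^ 2) Filter.atTop (nhds 0) := by
    simpa using h.top.pow 2
  have h2 : Filter.Tendsto (fun s => v s ^ 2) Filter.atTop (nhds (v t ^ 2)) := by
    rw [funext fun s => hc s t]; exact tendsto_const_nhds
  have h3 := tendsto_nhds_unique h2 h1
  simpa using h3

/-- For `N < 0` the solutions oscillate at `+∞`. Their energy `v'² - N v²` is, up to a bounded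
factor, nondecreasing, and so cannot tend to `0`. -/
theorem eq_zero_of_neg (h : IsMorseState B γ N v v₁) (hB : 0 ≤ B) (hN : N < 0) : v = 0 := by
  set ν := √(-N) with hν
  have hν0 : 0 < ν := Real.sqrt_pos.2 (by linarith)
  have hνN : ν ^ 2 = -N := Real.sq_sqrt (by linarith)
  -- `P' ν` dominates `|Q - N|`, and `P → 0` at `+∞`; hence `(v'² + ν² v²) e^P` is nondecreasing.
  let P : ℝ → ℝ := fun t => -((B * Real.exp (-t)) ^ 2 / 2 + 2 * B * |γ| * Real.exp (-t)) / ν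
  have hP : ∀ t, HasDerivAt P (((B * Real.exp (-t)) ^ 2 + 2 * B * |γ| * Real.exp (-t)) / ν) t := by
    intro t
    have h1 := hasDerivAt_exp_neg t
    refine (((((h1.const_mul B).pow 2).div_const 2).add
      (h1.const_mul (2 * B * |γ|))).neg.div_const ν).congr_deriv ?_
    simp only [Nat.cast_ofNat, Nat.add_one_sub_one, pow_one]
    ring
  have hE : ∀ t, HasDerivAt (fun t => v₁ t ^ 2 + ν ^ 2 * v t ^ 2)
      (2 * v t * v₁ t * ((B * Real.exp (-t)) ^ 2 - 2 * B * γ * Real.exp (-t))) t := by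
    intro t
    refine (((h.hasDerivAt₁ t).pow 2).add (((h.hasDerivAt t).pow 2).const_mul (ν ^ 2))).congr_deriv
      ?_
    simp only [Nat.cast_ofNat, Nat.add_one_sub_one, pow_one, hνN]
    ring
  have hmono : Monotone fun t => (v₁ t ^ 2 + ν ^ 2 * v t ^ 2) * Real.exp (P t) := by
    refine monotone_of_hasDerivAt_nonneg (fun t => (hE t).mul (hP t).exp) fun t => ?_
    set e := Real.exp (-t)
    have he : 0 < e := Real.exp_pos _
    set p := (B * e) ^ 2 + 2 * B * |γ| * e with hp
    set q := (B * e) ^ 2 - 2 * B * γ * e with hq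
    have hBe : 0 ≤ 2 * B * e := by positivity
    have hpq : |q| ≤ p := by
      rw [abs_le]
      constructor <;> nlinarith [neg_abs_le γ, le_abs_self γ, sq_nonneg (B * e)]
    have hp0 : 0 ≤ p := by positivity
    have h1 : |2 * v t * v₁ t * q| ≤ p * (v₁ t ^ 2 + ν ^ 2 * v t ^ 2) / ν := by
      rw [le_div_iff₀ hν0, abs_mul, mul_comm _ |q|, mul_assoc]
      refine mul_le_mul hpq ?_ (by positivity) hp0
      rw [← abs_of_pos hν0, ← abs_mul, abs_of_pos hν0, abs_le]
      constructor <;> nlinarith [sq_nonneg (v₁ t + ν * v t), sq_nonneg (v₁ t - ν * v t)]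
    have h2 := neg_abs_le (2 * v t * v₁ t * q)
    have h3 : 0 ≤ 2 * v t * v₁ t * q + p * (v₁ t ^ 2 + ν ^ 2 * v t ^ 2) / ν := by linarith
    have h4 := mul_nonneg h3 (Real.exp_pos (P t)).le
    simp only [Pi.zero_apply]
    refine h4.trans_eq ?_
    ring
  have hP0 : Filter.Tendsto P Filter.atTop (nhds 0) := by
    have h1 := tendsto_exp_neg_atTop
    have h2 := (((((h1.const_mul B).pow 2).div_const 2).add
      (h1.const_mul (2 * B * |γ|))).neg.div_const ν)
    norm_num at h2
    refine h2.congr fun t => ?_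
    simp only [P]
    ring
  have htop : Filter.Tendsto (fun t => (v₁ t ^ 2 + ν ^ 2 * v t ^ 2) * Real.exp (P t))
      Filter.atTop (nhds 0) := by
    simpa using ((h.top₁.pow 2).add ((h.top.pow 2).const_mul (ν ^ 2))).mul
      (hP0.rexp)
  funext t
  have h1 := hmono.ge_of_tendsto htop t
  have h2 : v₁ t ^ 2 + ν ^ 2 * v t ^ 2 ≤ 0 := by
    by_contra! h3
    exact absurd h1 (not_le.2 (mul_pos h3 (Real.exp_pos _)))
  have h3 : v t ^ 2 = 0 := by
    have : 0 < ν ^ 2 := by positivity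
    nlinarith [sq_nonneg (v₁ t), sq_nonneg (v t)]
  simpa using h3

/-- The kernel of the ladder operator is spanned by the ground state. -/
theorem eq_ground_of_lower_eq_zero (h : IsMorseState B γ N v v₁)
    (h0 : (fun t => v₁ t + superpotential B γ t * v t) = 0) (hv : v ≠ 0) (hB : 0 ≤ B) :
    0 < γ - 1 / 2 ∧ N = (γ - 1 / 2) ^ 2 ∧ ∃ c, v = fun t => c * morseFun B γ 0 t := by
  have hg : ∀ t, HasDerivAt (fun t => v t * (morseWeight B (γ - 1 / 2) t)⁻¹) 0 t := by
    intro t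
    have h1 : v₁ t = -superpotential B γ t * v t := by
      have := congrFun h0 t
      simp only [Pi.zero_apply] at this
      linarith
    have hw := (morseWeight_pos B (γ - 1 / 2) t).ne'
    refine ((h.hasDerivAt t).mul ((hasDerivAt_morseWeight B (γ - 1 / 2) t).inv hw)).congr_deriv ?_
    rw [h1]
    simp only [superpotential, Pi.inv_apply]
    field_simp
    ring
  have hc : ∃ c, v = fun t => c * morseWeight B (γ - 1 / 2) t := by
    refine ⟨v 0 * (morseWeight B (γ - 1 / 2) 0)⁻¹, funext fun t => ?_⟩
    rw [is_const_of_deriv_eq_zero (fun t => (hg t).differentiableAt) (fun t => (hg t).deriv) 0 t,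
      inv_mul_cancel_right₀ (morseWeight_pos B (γ - 1 / 2) t).ne']
  have e : morseFun B γ 0 = morseWeight B (γ - 1 / 2) := by
    funext t; simp [morseFun, besselPoly_zero]
  obtain ⟨c, hc⟩ := hc
  have hc0 : c ≠ 0 := by
    rintro rfl
    exact hv (by rw [hc]; funext t; simp)
  refine ⟨?_, ?_, c, by rw [hc, e]⟩
  · by_contra! hκ
    have h1 : Filter.Tendsto (fun t => c⁻¹ * v t) Filter.atTop (nhds 0) := by
      simpa using h.top.const_mul c⁻¹
    have h2 := h1.eventually_lt_const (Real.exp_pos (-B))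
    obtain ⟨t, ht, ht0⟩ := (h2.and (Filter.eventually_ge_atTop 0)).exists
    rw [hc, inv_mul_cancel_left₀ hc0, morseWeight, Real.exp_lt_exp] at ht
    have h3 : Real.exp (-t) ≤ 1 := Real.exp_le_one_iff.2 (by linarith)
    nlinarith
  · obtain ⟨t, ht⟩ := Function.ne_iff.1 hv
    have h1 := h.lower.hasDerivAt t
    rw [h0] at h1
    have h2 := h1.unique (hasDerivAt_const t (0 : ℝ))
    have h3 := congrFun h0 t
    simp only [Pi.zero_apply] at h3 ht
    rw [h3, mul_zero, zero_add] at h2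
    have := (mul_eq_zero.1 h2).resolve_right ht
    linarith

/-- Every nonzero Morse state is a multiple of an eigenfunction `morseFun B γ n`. The ladder operator
reduces `γ` until the potential is repulsive; the raising relation recovers `v` from its image. -/
theorem eq_zero_or_eq_morseFun (hB : 0 < B) (h : IsMorseState B γ N v v₁) :
    v = 0 ∨ ∃ n : ℕ, n < γ - 1 / 2 ∧ N = (γ - 1 / 2 - n) ^ 2 ∧
      ∃ c, v = fun t => c * morseFun B γ n t := by
  rcases lt_or_ge N 0 with hN | hN
  · exact Or.inl (h.eq_zero_of_neg hB.le hN)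
  obtain ⟨k, hk⟩ := exists_nat_ge γ
  induction k generalizing γ v v₁ with
  | zero => exact Or.inl (h.eq_zero_of_nonpos hB.le (by simpa using hk) hN)
  | succ k ih =>
    by_cases hv : v = 0
    · exact Or.inl hv
    refine Or.inr ?_
    rcases ih h.lower (by push_cast at hk; linarith) with h0 | ⟨n, hn, hNn, c, hc⟩
    · obtain ⟨h1, h2, h3⟩ := h.eq_ground_of_lower_eq_zero h0 hv hB.le
      exact ⟨0, by simpa using h1, by simpa using h2, h3⟩
    · refine ⟨n + 1, by push_cast; linarith, by rw [hNn]; push_cast; ring,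
        2 * B * c / (N - (γ - 1 / 2) ^ 2), funext fun t => ?_⟩
      have hne : N - (γ - 1 / 2) ^ 2 ≠ 0 := by
        rw [hNn]
        have : (0 : ℝ) ≤ n := n.cast_nonneg
        apply ne_of_lt
        nlinarith
      have h1 := h.lower.hasDerivAt t
      have h2 := congrFun hc t
      rw [h2, hc] at h1
      have h3 := h1.unique ((hasDerivAt_morseFun_raise hB.ne' γ n t).const_mul c)
      rw [div_mul_eq_mul_div, eq_div_iff hne]
      linear_combination h3

end IsMorseState

/-! ### Orthogonality and norms of the Morse eigenfunctions -/

/-- Substituting `q = e^{-t}` turns the integral of the weight into a Gamma integral. -/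
theorem integrable_and_integral_morseWeight {β δ : ℝ} (hβ : 0 < β) (hδ : 0 < δ) :
    Integrable (morseWeight β δ) ∧ ∫ t, morseWeight β δ t = (1 / β) ^ δ * Real.Gamma δ := by
  have himg : (fun t : ℝ => Real.exp (-t)) '' univ = Ioi 0 := by
    ext q
    simp only [image_univ, mem_range, mem_Ioi]
    refine ⟨fun ⟨t, ht⟩ => ht ▸ Real.exp_pos _, fun hq => ⟨-Real.log q, ?_⟩⟩
    rw [neg_neg, Real.exp_log hq]
  have hinj : InjOn (fun t : ℝ => Real.exp (-t)) univ := fun s _ t _ hst => by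
    simpa using hst
  have hd : ∀ t ∈ univ, HasDerivWithinAt (fun t : ℝ => Real.exp (-t)) (-Real.exp (-t)) univ t :=
    fun t _ => (hasDerivAt_exp_neg t).hasDerivWithinAt
  have e : (fun t => |-Real.exp (-t)| •
      (fun q : ℝ => q ^ (δ - 1) * Real.exp (-(β * q))) (Real.exp (-t))) = morseWeight β δ := by
    funext t
    simp only [abs_neg, Real.abs_exp, smul_eq_mul, morseWeight]
    rw [← Real.exp_mul, ← Real.exp_add, ← Real.exp_add]
    congr 1; ring
  have h1 := integrableOn_image_iff_integrableOn_abs_deriv_smul MeasurableSet.univ hd hinj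
    (fun q : ℝ => q ^ (δ - 1) * Real.exp (-(β * q)))
  have h2 := integral_image_eq_integral_abs_deriv_smul MeasurableSet.univ hd hinj
    (fun q : ℝ => q ^ (δ - 1) * Real.exp (-(β * q)))
  rw [himg, e] at h1 h2
  rw [integrableOn_univ] at h1
  rw [setIntegral_univ, Real.integral_rpow_mul_exp_neg_mul_Ioi hδ hβ] at h2
  refine ⟨h1.1 ?_, h2.symm⟩
  simpa using integrableOn_rpow_mul_exp_neg_mul_rpow (by linarith : -1 < δ - 1) one_pos hβ

theorem integrable_morseFun_mul {B γ : ℝ} (hB : 0 < B) {m n : ℕ} (hm : m < γ - 1 / 2)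
    (hn : n < γ - 1 / 2) : Integrable fun t => morseFun B γ m t * morseFun B γ n t := by
  simp only [morseFun_eq_sum, Finset.sum_mul_sum]
  refine integrable_finsetSum _ fun j hj => integrable_finsetSum _ fun k hk => ?_
  have hj' : (j : ℝ) ≤ m := by exact_mod_cast Nat.lt_succ_iff.1 (Finset.mem_range.1 hj)
  have hk' : (k : ℝ) ≤ n := by exact_mod_cast Nat.lt_succ_iff.1 (Finset.mem_range.1 hk)
  refine ((integrable_and_integral_morseWeight (β := 2 * B)
    (δ := (γ - 1 / 2 - j) + (γ - 1 / 2 - k)) (by linarith) (by linarith)).1.const_mul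
    (besselCoeff m (-(2 * γ)) j / B ^ j * (besselCoeff n (-(2 * γ)) k / B ^ k))).congr
    (Filter.Eventually.of_forall fun t => ?_)
  have : morseWeight (2 * B) ((γ - 1 / 2 - j) + (γ - 1 / 2 - k)) t =
      morseWeight B (γ - 1 / 2 - j) t * morseWeight B (γ - 1 / 2 - k) t := by
    unfold morseWeight; rw [← Real.exp_add]; congr 1; ring
  simp only [this]
  ring

/-- The inner product of two Morse eigenfunctions is, up to a factor, the one of their images under
the ladder operator: integrate the derivative of `u_m` times the image of `u_{n+1}`. For `m = 0` the
truncated `m - 1` is harmless, as the right-hand side vanishes. -/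
theorem integral_morseFun_mul_succ {B γ : ℝ} (hB : 0 < B) {m n : ℕ} (hm : m < γ - 1 / 2)
    (hn : (n + 1 : ℕ) < γ - 1 / 2) :
    (n + 1) * (2 * γ - n - 2) * ∫ t, morseFun B γ m t * morseFun B γ (n + 1) t =
      m * (m + 1 - 2 * γ) / (2 * B) * ((n + 1) * (n + 2 - 2 * γ) / (2 * B)) *
        ∫ t, morseFun B (γ - 1) (m - 1) t * morseFun B (γ - 1) n t := by
  push_cast at hn
  have hn0 : (0 : ℝ) ≤ n := n.cast_nonneg
  have hm' : ((m - 1 : ℕ) : ℝ) < γ - 1 - 1 / 2 := by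
    rcases m with _ | m
    · simp; linarith
    · push_cast at hm
      simp only [Nat.add_sub_cancel]
      linarith
  have hn' : (n : ℝ) < γ - 1 - 1 / 2 := by linarith
  have i1 := (integrable_morseFun_mul hB hm' hn').const_mul
    (m * (m + 1 - 2 * γ) / (2 * B) * ((n + 1) * (n + 2 - 2 * γ) / (2 * B)))
  have i2 := (integrable_morseFun_mul hB hm (n := n + 1) (by push_cast; linarith)).const_mul
    ((n + 1) * (n + 2 - 2 * γ))
  have hd : ∀ t, HasDerivAt
      (fun t => morseFun B γ m t *
        ((n + 1) * (n + 2 - 2 * γ) / (2 * B) * morseFun B (γ - 1) n t))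
      (m * (m + 1 - 2 * γ) / (2 * B) * ((n + 1) * (n + 2 - 2 * γ) / (2 * B)) *
          (morseFun B (γ - 1) (m - 1) t * morseFun B (γ - 1) n t) +
        (n + 1) * (n + 2 - 2 * γ) * (morseFun B γ m t * morseFun B γ (n + 1) t)) t := fun t => by
    refine ((hasDerivAt_morseFun hB.ne' γ m t).mul
      ((hasDerivAt_morseFun_raise hB.ne' γ n t).const_mul _)).congr_deriv ?_
    simp only [morseFunDeriv]
    field_simp
    ring
  have htop := (tendsto_morseFun_atTop (B := B) hm).mul
    ((tendsto_morseFun_atTop (B := B) hn').const_mul ((n + 1) * (n + 2 - 2 * γ) / (2 * B)))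
  have hbot := (tendsto_morseFun_atBot hB γ m 0).mul
    ((tendsto_morseFun_atBot hB (γ - 1) n 0).const_mul ((n + 1) * (n + 2 - 2 * γ) / (2 * B)))
  simp only [pow_zero, one_mul] at hbot
  have := integral_of_hasDerivAt_of_tendsto hd (i1.add i2) hbot htop
  rw [integral_add i1 i2, integral_const_mul, integral_const_mul] at this
  linear_combination -this

theorem integral_morseFun_mul_of_lt {B γ : ℝ} (hB : 0 < B) {m n : ℕ} (hmn : m < n)
    (hn : n < γ - 1 / 2) : ∫ t, morseFun B γ m t * morseFun B γ n t = 0 := by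
  induction n generalizing γ m with
  | zero => exact absurd hmn (Nat.not_lt_zero _)
  | succ n ih =>
    have hm : (m : ℝ) < γ - 1 / 2 := lt_trans (by exact_mod_cast hmn) hn
    have h := integral_morseFun_mul_succ hB hm hn
    push_cast at hn
    have hn0 : (0 : ℝ) ≤ n := n.cast_nonneg
    have hne : ((n : ℝ) + 1) * (2 * γ - n - 2) ≠ 0 :=
      mul_ne_zero (by positivity) (by linarith)
    rcases m with _ | m
    · simp only [Nat.cast_zero, zero_mul, zero_div] at h
      exact (mul_eq_zero.1 h).resolve_left hne
    · rw [Nat.add_sub_cancel, ih (by omega) (by linarith), mul_zero] at h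
      exact (mul_eq_zero.1 h).resolve_left hne

/-- The square norms of the Morse eigenfunctions, reduced along the ladder to the ground state. -/
theorem integral_morseFun_sq {B γ : ℝ} (hB : 0 < B) {n : ℕ} (hn : n < γ - 1 / 2) :
    ∫ t, morseFun B γ n t * morseFun B γ n t =
      n.factorial * Real.Gamma (2 * γ - n) / (2 * γ - 2 * n - 1) * (2 * B) ^ (1 - 2 * γ) := by
  induction n generalizing γ with
  | zero =>
    have e : (fun t => morseFun B γ 0 t * morseFun B γ 0 t) = morseWeight (2 * B) (2 * γ - 1) := by
      funext t
      simp only [morseFun, besselPoly_zero, morseWeight, mul_one]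
      rw [← Real.exp_add]; congr 1; ring
    simp only [Nat.cast_zero] at hn
    have hΓ := Real.Gamma_add_one (by linarith : 2 * γ - 1 ≠ 0)
    rw [sub_add_cancel] at hΓ
    have hne : 2 * γ - 1 ≠ 0 := by linarith
    rw [e, (integrable_and_integral_morseWeight (by linarith) (by linarith)).2]
    simp only [Nat.factorial_zero, Nat.cast_one, Nat.cast_zero, mul_zero, sub_zero, one_mul]
    rw [hΓ, mul_div_cancel_left₀ _ hne, one_div, Real.inv_rpow (by positivity),
      ← Real.rpow_neg (by positivity), neg_sub, mul_comm]
  | succ n ih =>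
    have h := integral_morseFun_mul_succ hB hn hn
    push_cast at hn
    have hn0 : (0 : ℝ) ≤ n := n.cast_nonneg
    have h1 : (n : ℝ) + 1 ≠ 0 := by positivity
    have h2 : 2 * γ - n - 2 ≠ 0 := by linarith
    have h3 : 2 * γ - 2 * n - 3 ≠ 0 := by linarith
    have hΓ := Real.Gamma_add_one h2
    have hpow : (2 * B) ^ (1 - 2 * (γ - 1)) = (2 * B) ^ (1 - 2 * γ) * (2 * B) ^ 2 := by
      rw [← Real.rpow_natCast, ← Real.rpow_add (by linarith)]
      congr 1; push_cast; ring
    rw [Nat.add_sub_cancel, ih (by linarith), hpow,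
      show 2 * (γ - 1) - n = 2 * γ - n - 2 by ring,
      show 2 * (γ - 1) - 2 * n - 1 = 2 * γ - 2 * n - 3 by ring] at h
    push_cast at h ⊢
    rw [show 2 * γ - (n + 1) = 2 * γ - n - 2 + 1 by ring, hΓ,
      show 2 * γ - 2 * (n + 1) - 1 = 2 * γ - 2 * n - 3 by ring, Nat.factorial_succ]
    push_cast
    refine mul_left_cancel₀ (mul_ne_zero h1 h2) (h.trans ?_)
    field_simp
    ring

/-! ### Decay of solutions at both ends -/

theorem tendsto_zero_of_sq {ι : Type*} {l : Filter ι} {f : ι → ℝ}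
    (h : Filter.Tendsto (fun i => f i ^ 2) l (nhds 0)) : Filter.Tendsto f l (nhds 0) := by
  have := h.sqrt
  simp only [Real.sqrt_sq_eq_abs, Real.sqrt_zero] at this
  exact (tendsto_zero_iff_abs_tendsto_zero f).2 this

theorem not_integrableOn_of_one_le {h : ℝ → ℝ} {T a : ℝ} (hT : ∀ t, T ≤ t → 1 ≤ h t) :
    ¬ IntegrableOn h (Ioi a) := by
  intro hi
  have h1 : IntegrableOn h (Ioi (max a T)) := hi.mono_set (Ioi_subset_Ioi (le_max_left _ _))
  have h2 : IntegrableOn (fun _ => (1 : ℝ)) (Ioi (max a T)) := by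
    refine Integrable.mono' h1 aestronglyMeasurable_const ?_
    refine (ae_restrict_iff' measurableSet_Ioi).2 (Filter.Eventually.of_forall fun t ht => ?_)
    simpa using hT t ((le_max_right _ _).trans (le_of_lt ht))
  rw [integrableOn_const_iff] at h2
  simp at h2

/-- Where `v'' = Q v` with `Q t ≥ e^{-t}`, a solution tending to `0` at `-∞` has `v²`, `v v'` and
`v'²` nondecreasing, and growing at least at a definite rate. -/
theorem sq_le_sq_add_two {Q v v₁ : ℝ → ℝ} {T : ℝ} (hQ : ∀ t ≤ T, Real.exp (-t) ≤ Q t)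
    (hv : ∀ t, HasDerivAt v (v₁ t) t) (hv₁ : ∀ t, HasDerivAt v₁ (Q t * v t) t)
    (hbot : Filter.Tendsto v Filter.atBot (nhds 0)) {t : ℝ} (ht : t + 2 ≤ T) :
    2 * Real.exp (-(t + 1)) * v t ^ 2 ≤ v (t + 2) ^ 2 ∧ 2 * v₁ t ^ 2 ≤ v (t + 2) ^ 2 := by
  have hQ0 : ∀ t ≤ T, 0 < Q t := fun t ht => (Real.exp_pos _).trans_le (hQ t ht)
  have dh : ∀ t, HasDerivAt (fun t => v t ^ 2) (2 * (v t * v₁ t)) t := fun t =>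
    ((hv t).pow 2).congr_deriv (by simp; ring)
  have dk : ∀ t, HasDerivAt (fun t => v t * v₁ t) (v₁ t ^ 2 + Q t * v t ^ 2) t := fun t =>
    ((hv t).mul (hv₁ t)).congr_deriv (by ring)
  have dg : ∀ t, HasDerivAt (fun t => v₁ t ^ 2) (2 * Q t * (v t * v₁ t)) t := fun t =>
    ((hv₁ t).pow 2).congr_deriv (by simp; ring)
  have mono : ∀ (f f' : ℝ → ℝ), (∀ t, HasDerivAt f (f' t) t) → (∀ t ≤ T, 0 ≤ f' t) →
      MonotoneOn f (Iic T) := fun f f' hf hf' =>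
    monotoneOn_of_deriv_nonneg (convex_Iic T)
      (fun t _ => (hf t).continuousAt.continuousWithinAt)
      (fun t _ => (hf t).differentiableAt.differentiableWithinAt)
      fun t ht => by
        rw [(hf t).deriv]
        exact hf' t (mem_Iic.1 (interior_subset ht))
  have mvt : ∀ (f f' : ℝ → ℝ), (∀ t, HasDerivAt f (f' t) t) → ∀ s t, s < t →
      ∃ c ∈ Ioo s t, f t - f s = f' c * (t - s) := fun f f' hf s t hst => by
    obtain ⟨c, hc, h⟩ := exists_hasDerivAt_eq_slope f f' hst
      (fun t _ => (hf t).continuousAt.continuousWithinAt) (fun t _ => hf t)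
    exact ⟨c, hc, by rw [h, div_mul_cancel₀ _ (by linarith)]⟩
  have mk := mono _ _ dk fun t ht => by
    have := (hQ0 t ht).le
    positivity
  -- If `v v'` were negative somewhere, `v²` would stay away from `0` to the left of that point.
  have k0 : ∀ t ≤ T, 0 ≤ v t * v₁ t := by
    intro t ht
    by_contra! hneg
    have h2 : Filter.Tendsto (fun s => v s ^ 2) Filter.atBot (nhds 0) := by simpa using hbot.pow 2
    obtain ⟨s, hs, hst⟩ := ((h2.eventually_lt_const (by linarith : 0 < -2 * (v t * v₁ t))).and
      (Filter.eventually_le_atBot (t - 1))).exists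
    obtain ⟨c, hc, h⟩ := mvt _ _ dh s t (by linarith)
    have h3 := mk (mem_Iic.2 (hc.2.le.trans ht)) (mem_Iic.2 ht) hc.2.le
    simp only at h3
    nlinarith [sq_nonneg (v t)]
  have mh := mono _ _ dh fun t ht => by have := k0 t ht; positivity
  have mg := mono _ _ dg fun t ht => by
    have := k0 t ht
    have := (hQ0 t ht).le
    positivity
  obtain ⟨c, hc, h1⟩ := mvt _ _ dk t (t + 1) (by linarith)
  obtain ⟨d, hd, h2⟩ := mvt _ _ dh (t + 1) (t + 2) (by linarith)
  have hcT : c ≤ T := by linarith [hc.2]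
  have h3 := mk (mem_Iic.2 (by linarith : t + 1 ≤ T)) (mem_Iic.2 (by linarith [hd.2])) hd.1.le
  have h4 := mh (mem_Iic.2 (by linarith : t ≤ T)) (mem_Iic.2 hcT) hc.1.le
  have h5 := mg (mem_Iic.2 (by linarith : t ≤ T)) (mem_Iic.2 hcT) hc.1.le
  have h6 : Real.exp (-(t + 1)) ≤ Q c :=
    (Real.exp_le_exp.2 (by linarith [hc.2])).trans (hQ c hcT)
  have h7 := k0 t (by linarith)
  simp only at h1 h2 h3 h4 h5
  have h8 : Real.exp (-(t + 1)) * v t ^ 2 ≤ Q c * v c ^ 2 :=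
    mul_le_mul h6 h4 (sq_nonneg _) (hQ0 c hcT).le
  have h9 : 0 ≤ Q c * v c ^ 2 := mul_nonneg (hQ0 c hcT).le (sq_nonneg _)
  constructor <;> nlinarith [sq_nonneg (v (t + 1)), sq_nonneg (v₁ c)]

/-- Iterating `sq_le_sq_add_two` gives decay faster than every power of `e^t`. -/
theorem tendsto_exp_neg_pow_mul_atBot {Q v v₁ : ℝ → ℝ} {T : ℝ}
    (hQ : ∀ t ≤ T, Real.exp (-t) ≤ Q t)
    (hv : ∀ t, HasDerivAt v (v₁ t) t) (hv₁ : ∀ t, HasDerivAt v₁ (Q t * v t) t)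
    (hbot : Filter.Tendsto v Filter.atBot (nhds 0)) (p : ℕ) :
    Filter.Tendsto (fun t => Real.exp (-t) ^ p * v t) Filter.atBot (nhds 0) ∧
      Filter.Tendsto (fun t => Real.exp (-t) ^ p * v₁ t) Filter.atBot (nhds 0) := by
  have hshift : Filter.Tendsto (fun t : ℝ => t + 2) Filter.atBot Filter.atBot :=
    Filter.tendsto_atBot_add_const_right _ _ Filter.tendsto_id
  have hev : ∀ᶠ t : ℝ in Filter.atBot, t + 2 ≤ T := by
    filter_upwards [Filter.eventually_le_atBot (T - 2)] with t ht
    linarith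
  have hexp : ∀ t, Real.exp (-t) = Real.exp 2 * Real.exp (-(t + 2)) := fun t => by
    rw [← Real.exp_add]; congr 1; ring
  have hsq : ∀ p : ℕ,
      Filter.Tendsto (fun t => Real.exp (-t) ^ p * v t ^ 2) Filter.atBot (nhds 0) := by
    intro p
    induction p with
    | zero => simpa using hbot.pow 2
    | succ p ih =>
      have h1 := (ih.comp hshift).const_mul (Real.exp 2 ^ p * Real.exp 1 / 2)
      rw [mul_zero] at h1
      refine squeeze_zero' (Filter.Eventually.of_forall fun t => by positivity) ?_ h1
      filter_upwards [hev] with t ht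
      have h2 := (sq_le_sq_add_two hQ hv hv₁ hbot ht).1
      have h3 : Real.exp (-t) = Real.exp 1 * Real.exp (-(t + 1)) := by
        rw [← Real.exp_add]; congr 1; ring
      simp only [Function.comp]
      calc Real.exp (-t) ^ (p + 1) * v t ^ 2
          = Real.exp (-t) ^ p * Real.exp 1 / 2 * (2 * Real.exp (-(t + 1)) * v t ^ 2) := by
            rw [pow_succ, h3]; ring
        _ ≤ Real.exp (-t) ^ p * Real.exp 1 / 2 * v (t + 2) ^ 2 := by gcongr
        _ = _ := by rw [hexp t, mul_pow]; ring
  constructor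
  · refine tendsto_zero_of_sq ((hsq (p * 2)).congr fun t => ?_)
    rw [pow_mul]; ring
  · refine tendsto_zero_of_sq ?_
    have h1 := ((hsq (p * 2)).comp hshift).const_mul (Real.exp 2 ^ (p * 2) / 2)
    rw [mul_zero] at h1
    refine squeeze_zero' (Filter.Eventually.of_forall fun t => by positivity) ?_ h1
    filter_upwards [hev] with t ht
    have h2 := (sq_le_sq_add_two hQ hv hv₁ hbot ht).2
    simp only [Function.comp]
    calc (Real.exp (-t) ^ p * v₁ t) ^ 2 = Real.exp (-t) ^ (p * 2) / 2 * (2 * v₁ t ^ 2) := by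
          rw [pow_mul]; ring
      _ ≤ Real.exp (-t) ^ (p * 2) / 2 * v (t + 2) ^ 2 := by gcongr
      _ = _ := by rw [hexp t, mul_pow]; ring

/-- If `v'' = Q v` with `Q` bounded and `v` is square integrable at `+∞`, then so is `v'`: otherwise
`(v v')' = v'² + Q v²` would force `v v' → ∞`. Hence both tend to `0`. -/
theorem tendsto_zero_atTop_of_integrableOn_sq {Q v v₁ : ℝ → ℝ} {K : ℝ} (hQc : Continuous Q)
    (hQ : ∀ t, 0 ≤ t → |Q t| ≤ K)
    (hv : ∀ t, HasDerivAt v (v₁ t) t) (hv₁ : ∀ t, HasDerivAt v₁ (Q t * v t) t)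
    (hint : IntegrableOn (fun t => v t ^ 2) (Ioi 0)) :
    Filter.Tendsto v Filter.atTop (nhds 0) ∧ Filter.Tendsto v₁ Filter.atTop (nhds 0) := by
  have cv : Continuous v := continuous_iff_continuousAt.2 fun t => (hv t).continuousAt
  have cv₁ : Continuous v₁ := continuous_iff_continuousAt.2 fun t => (hv₁ t).continuousAt
  have dh : ∀ t, HasDerivAt (fun t => v t ^ 2) (2 * (v t * v₁ t)) t := fun t =>
    ((hv t).pow 2).congr_deriv (by simp; ring)
  have dk : ∀ t, HasDerivAt (fun t => v t * v₁ t) (v₁ t ^ 2 + Q t * v t ^ 2) t := fun t =>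
    ((hv t).mul (hv₁ t)).congr_deriv (by ring)
  have dg : ∀ t, HasDerivAt (fun t => v₁ t ^ 2) (2 * (Q t * (v t * v₁ t))) t := fun t =>
    ((hv₁ t).pow 2).congr_deriv (by simp; ring)
  have hK : 0 ≤ K := (abs_nonneg _).trans (hQ 0 le_rfl)
  -- Otherwise `v²` would eventually grow linearly.
  have hfreq : ∃ᶠ t in Filter.atTop, v t * v₁ t ≤ 1 := by
    intro hev
    obtain ⟨T, hT⟩ := Filter.eventually_atTop.1 hev
    refine not_integrableOn_of_one_le (T := T + 1) (fun t ht => ?_) hint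
    obtain ⟨c, hc, h⟩ := exists_hasDerivAt_eq_slope (fun t => v t ^ 2) _
      (show T < t by linarith) (fun t _ => (dh t).continuousAt.continuousWithinAt) (fun t _ => dh t)
    have h1 := not_le.1 (hT c hc.1.le)
    rw [eq_div_iff (by linarith)] at h
    nlinarith [sq_nonneg (v T)]
  have iv₁ : IntegrableOn (fun t => v₁ t ^ 2) (Ioi 0) := by
    have hne : (Filter.atTop ⊓ Filter.principal {t | v t * v₁ t ≤ 1}).NeBot :=
      Filter.inf_principal_neBot_iff.2 fun U hU =>
        let ⟨t, ht⟩ := (hfreq.and_eventually hU).exists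
        ⟨t, ht.2, ht.1⟩
    -- `∫ v'²` is bounded along the end points `b` with `v v' ≤ 1`, which go to infinity.
    refine integrableOn_Ioi_of_intervalIntegral_norm_bounded
      (l := Filter.atTop ⊓ Filter.principal {t | v t * v₁ t ≤ 1}) (b := id)
      (1 - v 0 * v₁ 0 + K * ∫ t in Ioi 0, v t ^ 2) 0
      (fun b => ((cv₁.pow 2).integrableOn_Icc).mono_set Ioc_subset_Icc_self)
      (Filter.tendsto_id.mono_left inf_le_left) ?_
    have hb0 : ∀ᶠ b : ℝ in Filter.atTop ⊓ Filter.principal {t | v t * v₁ t ≤ 1}, 0 ≤ b :=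
      (Filter.eventually_ge_atTop 0).filter_mono inf_le_left
    have hb1 : ∀ᶠ b : ℝ in Filter.atTop ⊓ Filter.principal {t | v t * v₁ t ≤ 1},
        v b * v₁ b ≤ 1 := (Filter.mem_inf_of_right (Filter.mem_principal_self _))
    filter_upwards [hb0, hb1] with b hb hb'
    have i1 : IntervalIntegrable (fun t => v₁ t ^ 2) volume 0 b :=
      (cv₁.pow 2).intervalIntegrable _ _
    have i2 : IntervalIntegrable (fun t => Q t * v t ^ 2) volume 0 b :=
      (hQc.mul (cv.pow 2)).intervalIntegrable _ _
    have h1 := intervalIntegral.integral_eq_sub_of_hasDerivAt (fun t _ => dk t) (i1.add i2)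
    rw [intervalIntegral.integral_add i1 i2] at h1
    have h2 : -∫ t in (0 : ℝ)..b, Q t * v t ^ 2 ≤ K * ∫ t in Ioi 0, v t ^ 2 := by
      calc -∫ t in (0 : ℝ)..b, Q t * v t ^ 2 = ∫ t in (0 : ℝ)..b, -(Q t * v t ^ 2) := by
            rw [intervalIntegral.integral_neg]
        _ ≤ ∫ t in (0 : ℝ)..b, K * v t ^ 2 := by
            refine intervalIntegral.integral_mono_on hb i2.neg
              ((continuous_const.mul (cv.pow 2)).intervalIntegrable _ _) fun t ht => ?_
            have := (abs_le.1 (hQ t ht.1)).1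
            nlinarith [sq_nonneg (v t)]
        _ = K * ∫ t in Ioc 0 b, v t ^ 2 := by
            rw [intervalIntegral.integral_const_mul, intervalIntegral.integral_of_le hb]
        _ ≤ _ := by
            refine mul_le_mul_of_nonneg_left ?_ hK
            exact setIntegral_mono_set hint (Filter.Eventually.of_forall fun t => sq_nonneg _)
              (Filter.Eventually.of_forall Ioc_subset_Ioi_self)
    have h3 : ∫ t in (0 : ℝ)..id b, ‖v₁ t ^ 2‖ = ∫ t in (0 : ℝ)..b, v₁ t ^ 2 := by
      simp
    rw [h3]
    linarith
  have ik : IntegrableOn (fun t => v t * v₁ t) (Ioi 0) := by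
    refine Integrable.mono' (hint.add iv₁) (cv.mul cv₁).aestronglyMeasurable
      (Filter.Eventually.of_forall fun t => ?_)
    simp only [Pi.add_apply, Real.norm_eq_abs]
    rw [abs_le]
    constructor <;> nlinarith [sq_nonneg (v t + v₁ t), sq_nonneg (v t - v₁ t)]
  have iQk : IntegrableOn (fun t => Q t * (v t * v₁ t)) (Ioi 0) := by
    refine Integrable.mono' (ik.norm.const_mul K)
      (hQc.mul (cv.mul cv₁)).aestronglyMeasurable ?_
    refine (ae_restrict_iff' measurableSet_Ioi).2 (Filter.Eventually.of_forall fun t ht => ?_)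
    rw [norm_mul]
    exact mul_le_mul_of_nonneg_right (hQ t (le_of_lt ht)) (norm_nonneg _)
  exact ⟨tendsto_zero_of_sq (tendsto_zero_of_hasDerivAt_of_integrableOn_Ioi (fun t _ => dh t)
      (ik.const_mul 2) hint),
    tendsto_zero_of_sq (tendsto_zero_of_hasDerivAt_of_integrableOn_Ioi (fun t _ => dg t)
      (iQk.const_mul 2) iv₁)⟩

/-- A solution of the Morse equation that tends to `0` at `-∞` and is square integrable at `+∞` is a
Morse state. -/
theorem isMorseState_of_integrableOn {B γ N : ℝ} (hB : 0 < B) {v v₁ : ℝ → ℝ}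
    (hv : ∀ t, HasDerivAt v (v₁ t) t)
    (hv₁ : ∀ t, HasDerivAt v₁
      ((N - 2 * B * γ * Real.exp (-t) + (B * Real.exp (-t)) ^ 2) * v t) t)
    (hbot : Filter.Tendsto v Filter.atBot (nhds 0))
    (hint : IntegrableOn (fun t => v t ^ 2) (Ioi 0)) : IsMorseState B γ N v v₁ := by
  have hQbot : ∃ T, ∀ t ≤ T,
      Real.exp (-t) ≤ N - 2 * B * γ * Real.exp (-t) + (B * Real.exp (-t)) ^ 2 := by
    have h1 := tendsto_exp_neg_atBot.eventually_ge_atTop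
      -- a threshold beyond which `e = e^{-t}` satisfies `e ≤ N - 2 B γ e + B² e²`
      (max 1 ((1 + 2 * B * γ - N + |N|) / B ^ 2 + |N| / B ^ 2))
    obtain ⟨T, hT⟩ := Filter.eventually_atBot.1 h1
    refine ⟨T, fun t ht => ?_⟩
    have h2 := hT t ht
    set e := Real.exp (-t)
    have he1 : 1 ≤ e := (le_max_left _ _).trans h2
    have h3 := (le_max_right _ _).trans h2
    rw [← add_div, div_le_iff₀ (by positivity)] at h3
    have h4 : (1 + 2 * B * γ + |N|) * e ≤ e * B ^ 2 * e :=
      mul_le_mul_of_nonneg_right (by linarith [le_abs_self N]) (by linarith)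
    nlinarith [neg_abs_le N, abs_nonneg N]
  obtain ⟨T, hT⟩ := hQbot
  have hb := tendsto_exp_neg_pow_mul_atBot hT hv hv₁ hbot
  have ht := tendsto_zero_atTop_of_integrableOn_sq (K := |N| + 2 * B * |γ| + B ^ 2)
    (by fun_prop) (fun t ht => ?_) hv hv₁ hint
  · exact ⟨hv, hv₁, ht.1, ht.2, fun p => (hb p).1, fun p => (hb p).2⟩
  · have h0 := Real.exp_pos (-t)
    have h1 : Real.exp (-t) ≤ 1 := Real.exp_le_one_iff.2 (by linarith)
    refine (abs_add_le _ _).trans (add_le_add ((abs_sub _ _).trans (add_le_add le_rfl ?_)) ?_)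
    · rw [abs_mul, abs_mul, abs_of_pos h0, abs_of_pos (by linarith : 0 < 2 * B)]
      exact mul_le_of_le_one_right (by positivity) h1
    · rw [abs_of_nonneg (sq_nonneg _), mul_pow]
      exact mul_le_of_le_one_right (sq_nonneg _) (pow_le_one₀ h0.le h1)

/-! ### The logarithmic change of variable -/

theorem image_mul_exp_sub {a : ℝ} (ha : 0 < a) :
    (fun t : ℝ => a * Real.exp t - a) '' univ = Ioi (-a) := by
  ext x
  simp only [image_univ, mem_range, mem_Ioi]
  constructor
  · rintro ⟨t, rfl⟩
    linarith [mul_pos ha (Real.exp_pos t)]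
  · intro hx
    refine ⟨Real.log ((x + a) / a), ?_⟩
    rw [Real.exp_log (div_pos (by linarith) ha), mul_div_cancel₀ _ ha.ne']
    ring

theorem hasDerivAt_mul_exp_sub (a t : ℝ) :
    HasDerivAt (fun t : ℝ => a * Real.exp t - a) (a * Real.exp t) t :=
  ((Real.hasDerivAt_exp t).const_mul a).sub_const a

/-- The change of variable `x = a e^t - a` for functions vanishing inside the wall. -/
theorem integral_comp_mul_exp_sub {a : ℝ} (ha : 0 < a) {F : ℝ → ℝ} (hF : ∀ x ≤ -a, F x = 0) :
    (Integrable F ↔ Integrable fun t => a * Real.exp t * F (a * Real.exp t - a)) ∧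
      ∫ x, F x = ∫ t, a * Real.exp t * F (a * Real.exp t - a) := by
  have hinj : InjOn (fun t : ℝ => a * Real.exp t - a) univ := fun s _ t _ hst => by
    simpa [ha.ne'] using hst
  have hd : ∀ t ∈ univ, HasDerivWithinAt (fun t : ℝ => a * Real.exp t - a)
      (a * Real.exp t) univ t := fun t _ => (hasDerivAt_mul_exp_sub a t).hasDerivWithinAt
  have h1 := integrableOn_image_iff_integrableOn_abs_deriv_smul MeasurableSet.univ hd hinj F
  have h2 := integral_image_eq_integral_abs_deriv_smul MeasurableSet.univ hd hinj F
  rw [image_mul_exp_sub ha] at h1 h2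
  have e : ∀ t, |a * Real.exp t| = a * Real.exp t := fun t =>
    abs_of_pos (mul_pos ha (Real.exp_pos t))
  simp only [e, smul_eq_mul, integrableOn_univ, setIntegral_univ] at h1 h2
  rw [← h1, ← h2]
  constructor
  · refine (integrableOn_iff_integrable_of_support_subset fun x hx => ?_).symm
    by_contra h
    exact hx (hF x (not_lt.1 h))
  · exact (setIntegral_eq_integral_of_forall_compl_eq_zero fun x hx => hF x (not_lt.1 hx)).symm

/-- In the variable `t = log ((x + a) / a)` and with `f = e^{-t/2} v`, the Schrödinger equation
becomes the Morse equation. -/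
theorem hasDerivAt_morse_of_flux {a Λ ε : ℝ} (ha : 0 < a) {f D : ℝ → ℝ}
    (hf : ∀ x, -a < x → HasDerivAt f (D x) x)
    (hD : ∀ x, -a < x → HasDerivAt (fun y => (a + y) ^ 2 * D y)
      ((Λ ^ 2 * (x / (a + x)) ^ 2 - ε) * f x) x) (t : ℝ) :
    HasDerivAt (fun t => Real.exp (t / 2) * f (a * Real.exp t - a))
      (Real.exp (t / 2) * (f (a * Real.exp t - a) / 2 +
        a * Real.exp t * D (a * Real.exp t - a))) t ∧
    HasDerivAt (fun t => Real.exp (t / 2) * (f (a * Real.exp t - a) / 2 +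
        a * Real.exp t * D (a * Real.exp t - a)))
      ((1 / 4 - ε + Λ ^ 2 - 2 * Λ * Λ * Real.exp (-t) + (Λ * Real.exp (-t)) ^ 2) *
        (Real.exp (t / 2) * f (a * Real.exp t - a))) t := by
  have hx : -a < a * Real.exp t - a := by linarith [mul_pos ha (Real.exp_pos t)]
  have he : HasDerivAt (fun t : ℝ => Real.exp (t / 2)) (Real.exp (t / 2) * (1 / 2)) t :=
    ((hasDerivAt_id t).div_const 2).exp
  have h1 := (hf _ hx).comp t (hasDerivAt_mul_exp_sub a t)
  have h2 := (hD _ hx).comp t (hasDerivAt_mul_exp_sub a t)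
  have h3 : (fun t => Real.exp (t / 2) * (f (a * Real.exp t - a) / 2 +
        a * Real.exp t * D (a * Real.exp t - a))) = fun t => Real.exp (t / 2) *
        (f (a * Real.exp t - a) / 2 + Real.exp (-t) / a *
          ((fun y => (a + y) ^ 2 * D y) ∘ fun t => a * Real.exp t - a) t) := by
    funext s
    have := (Real.exp_pos s).ne'
    simp only [Function.comp, add_sub_cancel, Real.exp_neg]
    field_simp
  refine ⟨(he.mul h1).congr_deriv ?_, ?_⟩
  · simp only [Function.comp]
    ring
  · rw [h3]
    refine (he.mul ((h1.div_const 2).add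
      (((hasDerivAt_exp_neg t).div_const a).mul h2))).congr_deriv ?_
    have := (Real.exp_pos t).ne'
    simp only [Function.comp, add_sub_cancel, Real.exp_neg, Pi.add_apply, Pi.mul_apply]
    field_simp
    ring

/-- The converse of `hasDerivAt_morse_of_flux`: the Morse equation for `v` becomes the Schrödinger
equation for `f = e^{-t/2} v`, with flux `a e^{t/2} (v' - v/2)`. -/
theorem hasDerivAt_flux_of_morse {a Λ N : ℝ} (ha : 0 < a) {v v₁ : ℝ → ℝ}
    (hv : ∀ t, HasDerivAt v (v₁ t) t)
    (hv₁ : ∀ t, HasDerivAt v₁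
      ((N - 2 * Λ * Λ * Real.exp (-t) + (Λ * Real.exp (-t)) ^ 2) * v t) t)
    {x : ℝ} (hx : -a < x) :
    HasDerivAt (fun x => Real.exp (-(Real.log ((x + a) / a)) / 2) * v (Real.log ((x + a) / a)))
      (a * (Real.exp (Real.log ((x + a) / a) / 2) * (v₁ (Real.log ((x + a) / a)) -
        v (Real.log ((x + a) / a)) / 2)) / (a + x) ^ 2) x ∧
    HasDerivAt (fun x => a * (Real.exp (Real.log ((x + a) / a) / 2) *
      (v₁ (Real.log ((x + a) / a)) - v (Real.log ((x + a) / a)) / 2)))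
      ((Λ ^ 2 * (x / (a + x)) ^ 2 + N - Λ ^ 2 - 1 / 4) *
        (Real.exp (-(Real.log ((x + a) / a)) / 2) * v (Real.log ((x + a) / a)))) x := by
  have hs : 0 < (x + a) / a := div_pos (by linarith) ha
  have hτ : HasDerivAt (fun x => Real.log ((x + a) / a)) (1 / (a + x)) x := by
    refine ((((hasDerivAt_id x).add_const a).div_const a).log hs.ne').congr_deriv ?_
    have : x + a ≠ 0 := by linarith
    have : a + x ≠ 0 := by linarith
    simp only [id]
    field_simp
    ring
  have hxa : a + x ≠ 0 := by linarith
  have h1 := (hv _).comp x hτ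
  have h2 := (hv₁ _).comp x hτ
  have e1 := (hτ.neg.div_const 2).exp
  have e2 := (hτ.div_const 2).exp
  set τ := Real.log ((x + a) / a) with hτd
  have eτ : Real.exp τ = (x + a) / a := Real.exp_log hs
  have p1 : a + x = a * Real.exp (τ / 2) ^ 2 := by
    rw [← Real.exp_nat_mul, show ((2 : ℕ) : ℝ) * (τ / 2) = τ by push_cast; ring, eτ]
    field_simp
    ring
  have p2 : Real.exp (-τ / 2) = (Real.exp (τ / 2))⁻¹ := by
    rw [← Real.exp_neg]; congr 1; ring
  have p3 : Real.exp (-τ) = (Real.exp (τ / 2) ^ 2)⁻¹ := by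
    rw [← Real.exp_nat_mul, ← Real.exp_neg]; congr 1; push_cast; ring
  have p4 : x = a * Real.exp (τ / 2) ^ 2 - a := by linarith
  have hq := (Real.exp_pos (τ / 2)).ne'
  constructor
  · refine (e1.mul h1).congr_deriv ?_
    simp only [Function.comp, Pi.neg_apply]
    rw [← hτd, p2, p1]
    field_simp
    ring
  · refine ((e2.mul (h2.sub (h1.div_const 2))).const_mul a).congr_deriv ?_
    simp only [Function.comp, Pi.sub_apply]
    rw [← hτd, p3, p2, p1]
    generalize hqd : Real.exp (τ / 2) = q at *
    rw [p4]
    field_simp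
    ring

/-! ### Bound states of the Schrödinger equation -/

section

variable {ħ m₀ ω a : ℝ}

theorem lam₀_sq (hħ : 0 < ħ) (hm₀ : 0 < m₀) (hω : 0 < ω) : lam₀ ħ m₀ ω ^ 2 = m₀ * ω / ħ :=
  Real.sq_sqrt (by positivity)

theorem lam₀_sq_mul_pos (hħ : 0 < ħ) (hm₀ : 0 < m₀) (hω : 0 < ω) (ha : 0 < a) :
    0 < lam₀ ħ m₀ ω ^ 2 * a ^ 2 := by
  rw [lam₀_sq hħ hm₀ hω]; positivity

theorem wellPotential_eq_top_iff {x : ℝ} : wellPotential m₀ ω a x = ⊤ ↔ x ≤ -a := by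
  unfold wellPotential
  split_ifs with h
  · simp [h]
  · simpa using h

theorem one_div_mass (y : ℝ) : 1 / mass m₀ a y = (a ^ 2 * m₀)⁻¹ * (a + y) ^ 2 := by
  rw [mass, one_div_div, div_eq_inv_mul]

theorem toReal_wellPotential {x : ℝ} (hx : -a < x) :
    (wellPotential m₀ ω a x).toReal = mass m₀ a x * ω ^ 2 * x ^ 2 / 2 := by
  rw [wellPotential, if_pos hx, EReal.toReal_coe]

/-- The potential in the units in which the kinetic term is `-(d/dx) (a + x)² (d/dx)`. -/
theorem wellPotential_scaled (hħ : 0 < ħ) (hm₀ : 0 < m₀) (hω : 0 < ω) {x : ℝ} (hx : -a < x) :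
    2 * a ^ 2 * m₀ / ħ ^ 2 * (wellPotential m₀ ω a x).toReal =
      (lam₀ ħ m₀ ω ^ 2 * a ^ 2) ^ 2 * (x / (a + x)) ^ 2 := by
  have : a + x ≠ 0 := by linarith
  rw [toReal_wellPotential hx, lam₀_sq hħ hm₀ hω, mass]
  field_simp

/-- The energy levels are those for which the Morse parameter `N` is `(Λ - 1/2 - n)²`. -/
theorem energyLevel_eq_iff (hħ : 0 < ħ) (hm₀ : 0 < m₀) (hω : 0 < ω) (ha : 0 < a) (E : ℝ) (n : ℕ) :
    E = energyLevel ħ m₀ ω a n ↔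
      1 / 4 - 2 * a ^ 2 * m₀ / ħ ^ 2 * E + (lam₀ ħ m₀ ω ^ 2 * a ^ 2) ^ 2 =
        (lam₀ ħ m₀ ω ^ 2 * a ^ 2 - 1 / 2 - n) ^ 2 := by
  have h : 2 * a ^ 2 * m₀ / ħ ^ 2 * energyLevel ħ m₀ ω a n =
      1 / 4 + (lam₀ ħ m₀ ω ^ 2 * a ^ 2) ^ 2 - (lam₀ ħ m₀ ω ^ 2 * a ^ 2 - 1 / 2 - n) ^ 2 := by
    rw [lam₀_sq hħ hm₀ hω, energyLevel]
    field_simp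
    ring
  have h0 : 2 * a ^ 2 * m₀ / ħ ^ 2 ≠ 0 := by positivity
  constructor
  · rintro rfl
    linarith
  · intro h1
    exact mul_left_cancel₀ h0 (by linarith)

/-- Every real component of a bound state is a Morse state in the logarithmic variable. -/
theorem IsBoundState.isMorseState (hħ : 0 < ħ) (hm₀ : 0 < m₀) (hω : 0 < ω) (ha : 0 < a) {E : ℝ}
    {ψ : ℝ → ℂ} (h : IsBoundState ħ (mass m₀ a) (wellPotential m₀ ω a) E ψ) (φ : ℂ →L[ℝ] ℝ) :
    IsMorseState (lam₀ ħ m₀ ω ^ 2 * a ^ 2) (lam₀ ħ m₀ ω ^ 2 * a ^ 2)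
      (1 / 4 - 2 * a ^ 2 * m₀ / ħ ^ 2 * E + (lam₀ ħ m₀ ω ^ 2 * a ^ 2) ^ 2)
      (fun t => Real.exp (t / 2) * φ (ψ (a * Real.exp t - a)))
      (fun t => Real.exp (t / 2) * (φ (ψ (a * Real.exp t - a)) / 2 +
        a * Real.exp t * φ (deriv ψ (a * Real.exp t - a)))) := by
  have hV : ∀ x, -a < x → wellPotential m₀ ω a x ≠ ⊤ := fun x hx => by
    rw [Ne, wellPotential_eq_top_iff, not_le]; exact hx
  have hmul : ∀ (r : ℝ) (z : ℂ), φ (r * z) = r * φ z := fun r z => by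
    rw [← Complex.real_smul, map_smul, smul_eq_mul]
  have hf : ∀ x, -a < x → HasDerivAt (fun x => φ (ψ x)) (φ (deriv ψ x)) x := fun x hx =>
    φ.hasFDerivAt.comp_hasDerivAt x (h.differentiableAt x (hV x hx)).hasDerivAt
  have hD : ∀ x, -a < x → HasDerivAt (fun y => (a + y) ^ 2 * φ (deriv ψ y))
      (((lam₀ ħ m₀ ω ^ 2 * a ^ 2) ^ 2 * (x / (a + x)) ^ 2 - 2 * a ^ 2 * m₀ / ħ ^ 2 * E)
        * φ (ψ x)) x := fun x hx => by
    have h1 := (φ.hasFDerivAt.comp_hasDerivAt x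
      (h.differentiableAt_flux x (hV x hx)).hasDerivAt).const_mul (a ^ 2 * m₀)
    have e : (fun y => a ^ 2 * m₀ *
        (φ ∘ fun y => ((1 / mass m₀ a y : ℝ) : ℂ) * deriv ψ y) y) =
        fun y => (a + y) ^ 2 * φ (deriv ψ y) := by
      funext y
      simp only [Function.comp, hmul, one_div_mass]
      field_simp
    rw [e] at h1
    refine h1.congr_deriv ?_
    have h2 := congrArg φ (h.schrodinger x (hV x hx))
    rw [map_add, hmul, hmul, map_zero] at h2
    rw [← wellPotential_scaled hħ hm₀ hω hx]
    field_simp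
    linear_combination 2 * h2
  have hmain := hasDerivAt_morse_of_flux ha hf hD
  refine isMorseState_of_integrableOn (lam₀_sq_mul_pos hħ hm₀ hω ha) (fun t => (hmain t).1)
    (fun t => (hmain t).2) ?_ ?_
  · have h1 : Filter.Tendsto (fun t : ℝ => Real.exp (t / 2)) Filter.atBot (nhds 0) :=
      Real.tendsto_exp_atBot.comp (Filter.tendsto_id.atBot_div_const two_pos)
    have h2 : Filter.Tendsto (fun t : ℝ => a * Real.exp t - a) Filter.atBot (nhds (a * 0 - a)) :=
      (Real.tendsto_exp_atBot.const_mul a).sub_const a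
    have h3 := (((φ.continuous.comp h.continuous).tendsto _).comp h2)
    simpa using h1.mul h3
  · have h1 : MemLp (fun x => φ (ψ x)) 2 volume := φ.comp_memLp' h.memLp
    have h2 := h1.integrable_sq
    rw [(integral_comp_mul_exp_sub ha fun x hx => by
      simp [h.eq_zero_of_wall x (wellPotential_eq_top_iff.2 hx)]).1] at h2
    refine ((h2.const_mul a⁻¹).congr (Filter.Eventually.of_forall fun t => ?_)).integrableOn
    simp only
    rw [mul_pow, ← Real.exp_nat_mul, mul_assoc a, inv_mul_cancel_left₀ ha.ne',
      show ((2 : ℕ) : ℝ) * (t / 2) = t by push_cast; ring]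

theorem waveFun_of_le {n : ℕ} {x : ℝ} (hx : x ≤ -a) : waveFun ħ m₀ ω a n x = 0 :=
  if_neg (not_lt.2 hx)

/-- In the logarithmic variable, `ψ_n` is a Morse eigenfunction with `B = γ = λ₀² a²`. -/
theorem waveFun_mul_exp_sub (hħ : 0 < ħ) (hm₀ : 0 < m₀) (hω : 0 < ω) (ha : 0 < a) (n : ℕ) (t : ℝ) :
    waveFun ħ m₀ ω a n (a * Real.exp t - a) = normConst ħ m₀ ω a n *
      (Real.exp (-t / 2) * morseFun (lam₀ ħ m₀ ω ^ 2 * a ^ 2) (lam₀ ħ m₀ ω ^ 2 * a ^ 2) n t) := by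
  have hx : -a < a * Real.exp t - a := by linarith [mul_pos ha (Real.exp_pos t)]
  have hl : 0 < lam₀ ħ m₀ ω ^ 2 := by rw [lam₀_sq hħ hm₀ hω]; positivity
  have h1 : (a * Real.exp t - a) / a + 1 = Real.exp t := by field_simp; ring
  have h2 : lam₀ ħ m₀ ω ^ 2 * a ^ 3 / (a * Real.exp t - a + a) =
      lam₀ ħ m₀ ω ^ 2 * a ^ 2 * Real.exp (-t) := by
    have := (Real.exp_pos t).ne'
    rw [Real.exp_neg, sub_add_cancel]; field_simp
  have h3 : (a * Real.exp t - a + a) / (lam₀ ħ m₀ ω ^ 2 * a ^ 3) =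
      Real.exp t / (lam₀ ħ m₀ ω ^ 2 * a ^ 2) := by
    rw [sub_add_cancel]; field_simp
  rw [waveFun, if_pos hx, h1, h2, h3, morseFun, morseWeight, ← Real.exp_mul,
    ← mul_assoc 2 (lam₀ ħ m₀ ω ^ 2), mul_assoc (normConst ħ m₀ ω a n),
    mul_assoc (normConst ħ m₀ ω a n), ← Real.exp_add, ← mul_assoc (Real.exp (-t / 2)),
    ← Real.exp_add]
  congr 3
  ring

theorem normConst_pos (hħ : 0 < ħ) (hm₀ : 0 < m₀) (hω : 0 < ω) (ha : 0 < a) {n : ℕ}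
    (hn : n < lam₀ ħ m₀ ω ^ 2 * a ^ 2 - 1 / 2) : 0 < normConst ħ m₀ ω a n := by
  have hL := lam₀_sq_mul_pos hħ hm₀ hω ha
  have hn0 : (0 : ℝ) ≤ n := n.cast_nonneg
  unfold normConst
  rw [show 2 * lam₀ ħ m₀ ω ^ 2 * a ^ 3 = 2 * (lam₀ ħ m₀ ω ^ 2 * a ^ 2) * a by ring,
    mul_assoc 2 (lam₀ ħ m₀ ω ^ 2)]
  have hΓ := Real.Gamma_pos_of_pos
    (by linarith : 0 < 2 * (lam₀ ħ m₀ ω ^ 2 * a ^ 2) - n)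
  have : 0 < 2 * (lam₀ ħ m₀ ω ^ 2 * a ^ 2) - 2 * n - 1 := by linarith
  positivity

/-- `C_n` normalizes `ψ_n`: the factor after `a C_n²` is the square norm of the Morse eigenfunction. -/
theorem normConst_sq (hħ : 0 < ħ) (hm₀ : 0 < m₀) (hω : 0 < ω) (ha : 0 < a) {n : ℕ}
    (hn : n < lam₀ ħ m₀ ω ^ 2 * a ^ 2 - 1 / 2) :
    a * normConst ħ m₀ ω a n ^ 2 *
      (n.factorial * Real.Gamma (2 * (lam₀ ħ m₀ ω ^ 2 * a ^ 2) - n) /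
        (2 * (lam₀ ħ m₀ ω ^ 2 * a ^ 2) - 2 * n - 1) *
        (2 * (lam₀ ħ m₀ ω ^ 2 * a ^ 2)) ^ (1 - 2 * (lam₀ ħ m₀ ω ^ 2 * a ^ 2))) = 1 := by
  have hL := lam₀_sq_mul_pos hħ hm₀ hω ha
  have hn0 : (0 : ℝ) ≤ n := n.cast_nonneg
  unfold normConst
  rw [show 2 * lam₀ ħ m₀ ω ^ 2 * a ^ 3 = 2 * (lam₀ ħ m₀ ω ^ 2 * a ^ 2) * a by ring,
    mul_assoc 2 (lam₀ ħ m₀ ω ^ 2)]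
  generalize lam₀ ħ m₀ ω ^ 2 * a ^ 2 = L at *
  have hΓ := Real.Gamma_pos_of_pos (by linarith : 0 < 2 * L - n)
  have h1 : 0 < 2 * L - 2 * n - 1 := by linarith
  have h2 : (2 * L) ^ (1 - 2 * L) = 2 * L / ((2 * L) ^ L) ^ 2 := by
    rw [Real.rpow_sub (by linarith), Real.rpow_one, mul_comm 2 L, mul_comm L 2,
      mul_comm 2 L, Real.rpow_mul (by linarith), ← Real.rpow_natCast, ← Real.rpow_mul,
      ← Real.rpow_mul]
    all_goals first | positivity | skip
    push_cast; rfl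
  have h3 : (0 : ℝ) < (2 * L) ^ L := Real.rpow_pos_of_pos (by linarith) _
  rw [mul_pow, Real.sq_sqrt (by positivity), h2]
  have h4 : (0 : ℝ) < n.factorial := by positivity
  generalize 2 * L - 2 * n - 1 = q at *
  field_simp

theorem integrable_waveFun_mul (hħ : 0 < ħ) (hm₀ : 0 < m₀) (hω : 0 < ω) (ha : 0 < a) {m n : ℕ}
    (hm : m < lam₀ ħ m₀ ω ^ 2 * a ^ 2 - 1 / 2) (hn : n < lam₀ ħ m₀ ω ^ 2 * a ^ 2 - 1 / 2) :
    Integrable (fun x => waveFun ħ m₀ ω a m x * waveFun ħ m₀ ω a n x) volume ∧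
      ∫ x, waveFun ħ m₀ ω a m x * waveFun ħ m₀ ω a n x = if m = n then 1 else 0 := by
  have hL := lam₀_sq_mul_pos hħ hm₀ hω ha
  have hcv := integral_comp_mul_exp_sub ha
    (F := fun x => waveFun ħ m₀ ω a m x * waveFun ħ m₀ ω a n x)
    fun x hx => by simp [waveFun_of_le hx]
  have e : (fun t => a * Real.exp t * (waveFun ħ m₀ ω a m (a * Real.exp t - a) *
      waveFun ħ m₀ ω a n (a * Real.exp t - a))) = fun t =>
      a * (normConst ħ m₀ ω a m * normConst ħ m₀ ω a n) *
        (morseFun (lam₀ ħ m₀ ω ^ 2 * a ^ 2) (lam₀ ħ m₀ ω ^ 2 * a ^ 2) m t *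
          morseFun (lam₀ ħ m₀ ω ^ 2 * a ^ 2) (lam₀ ħ m₀ ω ^ 2 * a ^ 2) n t) := by
    funext t
    have : Real.exp t * (Real.exp (-t / 2) * Real.exp (-t / 2)) = 1 := by
      rw [← Real.exp_add, ← Real.exp_add, ← Real.exp_zero]; congr 1; ring
    rw [waveFun_mul_exp_sub hħ hm₀ hω ha, waveFun_mul_exp_sub hħ hm₀ hω ha]
    linear_combination a * (normConst ħ m₀ ω a m * normConst ħ m₀ ω a n) *
        (morseFun (lam₀ ħ m₀ ω ^ 2 * a ^ 2) (lam₀ ħ m₀ ω ^ 2 * a ^ 2) m t *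
          morseFun (lam₀ ħ m₀ ω ^ 2 * a ^ 2) (lam₀ ħ m₀ ω ^ 2 * a ^ 2) n t) * this
  simp only [e] at hcv
  refine ⟨hcv.1.2 ((integrable_morseFun_mul hL hm hn).const_mul _), ?_⟩
  rw [hcv.2, integral_const_mul]
  split_ifs with hmn
  · subst hmn
    rw [integral_morseFun_sq hL hm, ← sq]
    exact normConst_sq hħ hm₀ hω ha hm
  · rcases lt_or_gt_of_ne hmn with h | h
    · rw [integral_morseFun_mul_of_lt hL h hn, mul_zero]
    · simp only [mul_comm (morseFun _ _ m _)]
      rw [integral_morseFun_mul_of_lt hL h hm, mul_zero]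

theorem waveFun_eq_log (hħ : 0 < ħ) (hm₀ : 0 < m₀) (hω : 0 < ω) (ha : 0 < a) (n : ℕ) {x : ℝ}
    (hx : -a < x) :
    waveFun ħ m₀ ω a n x = normConst ħ m₀ ω a n * (Real.exp (-(Real.log ((x + a) / a)) / 2) *
      morseFun (lam₀ ħ m₀ ω ^ 2 * a ^ 2) (lam₀ ħ m₀ ω ^ 2 * a ^ 2) n
        (Real.log ((x + a) / a))) := by
  rw [← waveFun_mul_exp_sub hħ hm₀ hω ha, Real.exp_log (div_pos (by linarith) ha),
    mul_div_cancel₀ _ ha.ne', add_sub_cancel_right]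

/-- `ψ_n` solves the Schrödinger equation outside of the wall, with `D` its derivative. -/
theorem exists_hasDerivAt_waveFun (hħ : 0 < ħ) (hm₀ : 0 < m₀) (hω : 0 < ω) (ha : 0 < a) (n : ℕ) :
    ∃ D : ℝ → ℝ, (∀ x, -a < x → HasDerivAt (waveFun ħ m₀ ω a n) (D x) x) ∧
      ∀ x, -a < x → HasDerivAt (fun y => (a + y) ^ 2 * D y)
        (((lam₀ ħ m₀ ω ^ 2 * a ^ 2) ^ 2 * (x / (a + x)) ^ 2 -
          2 * a ^ 2 * m₀ / ħ ^ 2 * energyLevel ħ m₀ ω a n) * waveFun ħ m₀ ω a n x) x := by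
  have hL := lam₀_sq_mul_pos hħ hm₀ hω ha
  have hE := (energyLevel_eq_iff hħ hm₀ hω ha _ n).1 rfl
  set L := lam₀ ħ m₀ ω ^ 2 * a ^ 2 with hLd
  set F : ℝ → ℝ := fun x => a * (Real.exp (Real.log ((x + a) / a) / 2) *
    (morseFunDeriv L L n (Real.log ((x + a) / a)) - morseFun L L n (Real.log ((x + a) / a)) / 2))
    with hF
  have hmain := fun {x : ℝ} (hx : -a < x) => hasDerivAt_flux_of_morse ha
    (hasDerivAt_morseFun hL.ne' L n) (hasDerivAt_morseFunDeriv hL.ne' L n) hx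
  refine ⟨fun x => normConst ħ m₀ ω a n * (F x / (a + x) ^ 2), fun x hx => ?_, fun x hx => ?_⟩
  · refine ((hmain hx).1.const_mul (normConst ħ m₀ ω a n)).congr_of_eventuallyEq ?_
    filter_upwards [lt_mem_nhds hx] with y hy
    exact waveFun_eq_log hħ hm₀ hω ha n hy
  · have h1 := (hmain hx).2.const_mul (normConst ħ m₀ ω a n)
    have h2 : HasDerivAt (fun y => (a + y) ^ 2 * (normConst ħ m₀ ω a n * (F y / (a + y) ^ 2))) _ x :=
      h1.congr_of_eventuallyEq (by
        filter_upwards [lt_mem_nhds hx] with y hy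
        have : a + y ≠ 0 := by linarith
        simp only [hF]
        field_simp)
    refine h2.congr_deriv ?_
    rw [waveFun_eq_log hħ hm₀ hω ha n hx, ← hLd]
    linear_combination -normConst ħ m₀ ω a n * (Real.exp (-(Real.log ((x + a) / a)) / 2) *
      morseFun L L n (Real.log ((x + a) / a))) * hE

theorem continuous_waveFun (hħ : 0 < ħ) (hm₀ : 0 < m₀) (hω : 0 < ω) (ha : 0 < a) (n : ℕ) :
    Continuous (waveFun ħ m₀ ω a n) := by
  have hL := lam₀_sq_mul_pos hħ hm₀ hω ha
  obtain ⟨D, hD, -⟩ := exists_hasDerivAt_waveFun hħ hm₀ hω ha n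
  refine continuous_iff_continuousAt.2 fun x => ?_
  rcases lt_trichotomy x (-a) with hx | rfl | hx
  · refine (continuousAt_const (y := (0 : ℝ))).congr ?_
    filter_upwards [gt_mem_nhds hx] with y hy
    exact (waveFun_of_le hy.le).symm
  · refine continuousAt_iff_continuous_left'_right'.2 ⟨?_, ?_⟩
    · refine (continuousWithinAt_const (b := (0 : ℝ))).congr (fun y hy => waveFun_of_le (le_of_lt hy))
        (waveFun_of_le le_rfl)
    · have h1 : Filter.Tendsto (fun x => (x + a) / a) (nhdsWithin (-a) (Ioi (-a)))
          (nhdsWithin 0 (Ioi 0)) := by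
        refine tendsto_nhdsWithin_iff.2 ⟨?_, ?_⟩
        · have : ContinuousAt (fun x : ℝ => (x + a) / a) (-a) := by fun_prop
          have h2 := this.tendsto
          simp only [neg_add_cancel, zero_div] at h2
          exact h2.mono_left nhdsWithin_le_nhds
        · filter_upwards [self_mem_nhdsWithin] with y hy
          exact div_pos (by linarith [mem_Ioi.1 hy]) ha
      have h2 := Real.tendsto_log_nhdsGT_zero.comp h1
      -- At the wall `t → -∞`, where the eigenfunction beats the factor `e^{-t/2}`.
      have h3 : Filter.Tendsto (fun t => Real.exp (-t / 2) *
          morseFun (lam₀ ħ m₀ ω ^ 2 * a ^ 2) (lam₀ ħ m₀ ω ^ 2 * a ^ 2) n t)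
          Filter.atBot (nhds 0) := by
        refine tendsto_zero_of_sq ?_
        have h4 := (tendsto_morseFun_atBot hL (lam₀ ħ m₀ ω ^ 2 * a ^ 2) n 1).mul
          (tendsto_morseFun_atBot hL (lam₀ ħ m₀ ω ^ 2 * a ^ 2) n 0)
        simp only [mul_zero] at h4
        refine h4.congr fun t => ?_
        have : Real.exp (-t) = Real.exp (-t / 2) ^ 2 := by
          rw [← Real.exp_nat_mul]; congr 1; push_cast; ring
        rw [this]
        ring
      have h5 := (h3.comp h2).const_mul (normConst ħ m₀ ω a n)
      rw [mul_zero] at h5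
      unfold ContinuousWithinAt
      rw [waveFun_of_le le_rfl]
      refine h5.congr' ?_
      filter_upwards [self_mem_nhdsWithin] with y hy
      exact (waveFun_eq_log hħ hm₀ hω ha n hy).symm
  · exact (hD x hx).continuousAt

theorem isBoundState_waveFun (hħ : 0 < ħ) (hm₀ : 0 < m₀) (hω : 0 < ω) (ha : 0 < a) {n : ℕ}
    (hn : n < lam₀ ħ m₀ ω ^ 2 * a ^ 2 - 1 / 2) {c : ℂ} (hc : c ≠ 0) :
    IsBoundState ħ (mass m₀ a) (wellPotential m₀ ω a) (energyLevel ħ m₀ ω a n)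
      (fun x => c * (waveFun ħ m₀ ω a n x : ℂ)) := by
  obtain ⟨D, hD, hD₂⟩ := exists_hasDerivAt_waveFun hħ hm₀ hω ha n
  have hcont := continuous_waveFun hħ hm₀ hω ha n
  have hV : ∀ x, wellPotential m₀ ω a x ≠ ⊤ → -a < x := fun x hx => by
    rw [Ne, wellPotential_eq_top_iff, not_le] at hx; exact hx
  have hψ : ∀ x, -a < x →
      HasDerivAt (fun x => c * (waveFun ħ m₀ ω a n x : ℂ)) (c * (D x : ℂ)) x := fun x hx =>
    (hD x hx).ofReal_comp.const_mul c
  have hflux : ∀ x, -a < x → HasDerivAt (fun y => ((1 / mass m₀ a y : ℝ) : ℂ) *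
      deriv (fun x => c * (waveFun ħ m₀ ω a n x : ℂ)) y)
      (c * (((a ^ 2 * m₀)⁻¹ * (((lam₀ ħ m₀ ω ^ 2 * a ^ 2) ^ 2 * (x / (a + x)) ^ 2 -
          2 * a ^ 2 * m₀ / ħ ^ 2 * energyLevel ħ m₀ ω a n) * waveFun ħ m₀ ω a n x) : ℝ) : ℂ))
      x := fun x hx => by
    refine (((hD₂ x hx).const_mul (a ^ 2 * m₀)⁻¹).ofReal_comp.const_mul c).congr_of_eventuallyEq ?_
    filter_upwards [lt_mem_nhds hx] with y hy
    rw [(hψ y hy).deriv, one_div_mass]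
    push_cast
    ring
  have hint := integrable_waveFun_mul hħ hm₀ hω ha hn hn
  refine ⟨continuous_const.mul (Complex.continuous_ofReal.comp hcont), fun x hx => ?_,
    fun x hx => (hψ x (hV x hx)).differentiableAt,
    fun x hx => (hflux x (hV x hx)).differentiableAt, fun x hx => ?_, ?_, fun h0 => ?_⟩
  · simp [waveFun_of_le (wellPotential_eq_top_iff.1 hx)]
  · rw [(hflux x (hV x hx)).deriv, ← wellPotential_scaled hħ hm₀ hω (hV x hx)]
    have h1 : ((ħ : ℝ) : ℂ) ≠ 0 := by exact_mod_cast hħ.ne'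
    have h2 : ((a : ℝ) : ℂ) ≠ 0 := by exact_mod_cast ha.ne'
    have h3 : ((m₀ : ℝ) : ℂ) ≠ 0 := by exact_mod_cast hm₀.ne'
    push_cast
    field_simp
    ring
  · have h1 : MemLp (waveFun ħ m₀ ω a n) 2 volume := by
      rw [memLp_two_iff_integrable_sq hcont.aestronglyMeasurable]
      simpa only [sq] using hint.1
    exact (h1.ofReal (K := ℂ)).const_mul c
  · have h1 : ∀ x, waveFun ħ m₀ ω a n x = 0 := fun x => by
      have := congrFun h0 x
      simpa [hc] using this
    simpa [h1] using hint.2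

/-- Every bound state is a multiple of some `ψ_n`: the classification of Morse states, applied to the
real and the imaginary part. -/
theorem IsBoundState.exists_eq_waveFun (hħ : 0 < ħ) (hm₀ : 0 < m₀) (hω : 0 < ω) (ha : 0 < a)
    {E : ℝ} {ψ : ℝ → ℂ} (h : IsBoundState ħ (mass m₀ a) (wellPotential m₀ ω a) E ψ) :
    ∃ n : ℕ, (n : ℝ) < lam₀ ħ m₀ ω ^ 2 * a ^ 2 - 1 / 2 ∧ E = energyLevel ħ m₀ ω a n ∧
      ∃ c : ℂ, c ≠ 0 ∧ ψ = fun x => c * (waveFun ħ m₀ ω a n x : ℂ) := by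
  have hL := lam₀_sq_mul_pos hħ hm₀ hω ha
  have hcl := fun φ => (h.isMorseState hħ hm₀ hω ha φ).eq_zero_or_eq_morseFun hL
  have hwall : ∀ x ≤ -a, ψ x = 0 := fun x hx =>
    h.eq_zero_of_wall x (wellPotential_eq_top_iff.2 hx)
  have hlog : ∀ x, -a < x → a * Real.exp (Real.log ((x + a) / a)) - a = x := fun x hx => by
    rw [Real.exp_log (div_pos (by linarith) ha), mul_div_cancel₀ _ ha.ne', add_sub_cancel_right]
  -- A real component that is not zero determines `n`.
  obtain ⟨n, hn, hN⟩ : ∃ n : ℕ, (n : ℝ) < lam₀ ħ m₀ ω ^ 2 * a ^ 2 - 1 / 2 ∧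
      1 / 4 - 2 * a ^ 2 * m₀ / ħ ^ 2 * E + (lam₀ ħ m₀ ω ^ 2 * a ^ 2) ^ 2 =
        (lam₀ ħ m₀ ω ^ 2 * a ^ 2 - 1 / 2 - n) ^ 2 := by
    rcases hcl Complex.reCLM with h1 | ⟨n, hn, hN, -⟩
    · rcases hcl Complex.imCLM with h2 | ⟨n, hn, hN, -⟩
      · refine absurd (funext fun x => ?_) h.ne_zero
        rcases le_or_gt x (-a) with hx | hx
        · exact hwall x hx
        · have h3 := congrFun h1 (Real.log ((x + a) / a))
          have h4 := congrFun h2 (Real.log ((x + a) / a))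
          simp only [hlog x hx, Pi.zero_apply, mul_eq_zero, Real.exp_ne_zero, false_or,
            Complex.reCLM_apply, Complex.imCLM_apply] at h3 h4
          exact Complex.ext h3 h4
      · exact ⟨n, hn, hN⟩
    · exact ⟨n, hn, hN⟩
  -- Each real component is a multiple of `ψ_n` with this `n`, since `N` determines `n < Λ - 1/2`.
  have hcomp : ∀ φ : ℂ →L[ℝ] ℝ, ∃ r : ℝ, ∀ x, φ (ψ x) = r * waveFun ħ m₀ ω a n x := fun φ => by
    rcases hcl φ with h1 | ⟨m, hm, hM, r, hr⟩
    · refine ⟨0, fun x => ?_⟩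
      rcases le_or_gt x (-a) with hx | hx
      · simp [hwall x hx]
      · have h3 := congrFun h1 (Real.log ((x + a) / a))
        simpa only [hlog x hx, Pi.zero_apply, mul_eq_zero, Real.exp_ne_zero, false_or,
          zero_mul] using h3
    · have hmn : m = n := by
        rw [hN] at hM
        have := (sq_eq_sq₀ (by linarith) (by linarith)).1 hM
        exact_mod_cast (by linarith : (m : ℝ) = n)
      subst hmn
      refine ⟨r / normConst ħ m₀ ω a m, fun x => ?_⟩
      rcases le_or_gt x (-a) with hx | hx
      · simp [hwall x hx, waveFun_of_le hx]
      · have h3 := congrFun hr (Real.log ((x + a) / a))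
        simp only [hlog x hx] at h3
        have hC := (normConst_pos hħ hm₀ hω ha hm).ne'
        have h4 : Real.exp (-(Real.log ((x + a) / a)) / 2) *
            Real.exp (Real.log ((x + a) / a) / 2) = 1 := by
          rw [← Real.exp_add, ← Real.exp_zero]; congr 1; ring
        rw [waveFun_eq_log hħ hm₀ hω ha m hx, ← mul_assoc, div_mul_cancel₀ _ hC]
        linear_combination Real.exp (-(Real.log ((x + a) / a)) / 2) * h3 - φ (ψ x) * h4
  obtain ⟨r, hr⟩ := hcomp Complex.reCLM
  obtain ⟨s, hs⟩ := hcomp Complex.imCLM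
  have hψ : ψ = fun x => (⟨r, s⟩ : ℂ) * (waveFun ħ m₀ ω a n x : ℂ) := by
    funext x
    apply Complex.ext
    · simpa using hr x
    · simpa using hs x
  refine ⟨n, hn, (energyLevel_eq_iff hħ hm₀ hω ha E n).2 hN, ⟨r, s⟩, fun h0 => ?_, hψ⟩
  refine h.ne_zero ?_
  rw [hψ, h0]
  funext x
  simp

/-- `E_n` increases because `(Λ - 1/2 - n)²` decreases for `n < Λ - 1/2`. -/
theorem strictMonoOn_energyLevel (hħ : 0 < ħ) (hm₀ : 0 < m₀) (hω : 0 < ω) (ha : 0 < a) :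
    StrictMonoOn (energyLevel ħ m₀ ω a)
      {n : ℕ | (n : ℝ) < lam₀ ħ m₀ ω ^ 2 * a ^ 2 - 1 / 2} := by
  intro m hm n hn hmn
  have hmn' : (m : ℝ) < n := by exact_mod_cast hmn
  have h1 := (energyLevel_eq_iff hħ hm₀ hω ha _ m).1 rfl
  have h2 := (energyLevel_eq_iff hħ hm₀ hω ha _ n).1 rfl
  simp only [mem_ofPred_eq] at hm hn
  have h0 : 0 < 2 * a ^ 2 * m₀ / ħ ^ 2 := by positivity
  refine lt_of_mul_lt_mul_left ?_ h0.le
  nlinarith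

end

theorem mainTheorem2 (ħ m₀ ω a : ℝ) (hħ : 0 < ħ) (hm₀ : 0 < m₀) (hω : 0 < ω) (ha : 0 < a) :
    (∀ (E : ℝ) (ψ : ℝ → ℂ),
      IsBoundState ħ (mass m₀ a) (wellPotential m₀ ω a) E ψ ↔
        ∃ n : ℕ, (n : ℝ) < lam₀ ħ m₀ ω ^ 2 * a ^ 2 - 1 / 2 ∧
          E = energyLevel ħ m₀ ω a n ∧
          ∃ c : ℂ, c ≠ 0 ∧ ψ = fun x => c * (waveFun ħ m₀ ω a n x : ℂ)) ∧
    (∀ m n : ℕ, (m : ℝ) < lam₀ ħ m₀ ω ^ 2 * a ^ 2 - 1 / 2 →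
      (n : ℝ) < lam₀ ħ m₀ ω ^ 2 * a ^ 2 - 1 / 2 →
        Integrable (fun x => waveFun ħ m₀ ω a m x * waveFun ħ m₀ ω a n x) volume ∧
        ∫ x, waveFun ħ m₀ ω a m x * waveFun ħ m₀ ω a n x = if m = n then 1 else 0) ∧
    StrictMonoOn (energyLevel ħ m₀ ω a) {n : ℕ | (n : ℝ) < lam₀ ħ m₀ ω ^ 2 * a ^ 2 - 1 / 2} ∧
    (1 / 2 < lam₀ ħ m₀ ω ^ 2 * a ^ 2 →
      ∃ N : ℕ, IsGreatest {n : ℕ | (n : ℝ) < lam₀ ħ m₀ ω ^ 2 * a ^ 2 - 1 / 2} N ∧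
        boundEnergies ħ (mass m₀ a) (wellPotential m₀ ω a) = energyLevel ħ m₀ ω a '' Set.Iic N) ∧
    (lam₀ ħ m₀ ω ^ 2 * a ^ 2 ≤ 1 / 2 →
      boundEnergies ħ (mass m₀ a) (wellPotential m₀ ω a) = ∅) := by
  have hiff : ∀ (E : ℝ) (ψ : ℝ → ℂ),
      IsBoundState ħ (mass m₀ a) (wellPotential m₀ ω a) E ψ ↔
        ∃ n : ℕ, (n : ℝ) < lam₀ ħ m₀ ω ^ 2 * a ^ 2 - 1 / 2 ∧
          E = energyLevel ħ m₀ ω a n ∧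
          ∃ c : ℂ, c ≠ 0 ∧ ψ = fun x => c * (waveFun ħ m₀ ω a n x : ℂ) := fun E ψ => by
    refine ⟨fun h => h.exists_eq_waveFun hħ hm₀ hω ha, ?_⟩
    rintro ⟨n, hn, rfl, c, hc, rfl⟩
    exact isBoundState_waveFun hħ hm₀ hω ha hn hc
  have hen : ∀ E, E ∈ boundEnergies ħ (mass m₀ a) (wellPotential m₀ ω a) ↔
      ∃ n : ℕ, (n : ℝ) < lam₀ ħ m₀ ω ^ 2 * a ^ 2 - 1 / 2 ∧ energyLevel ħ m₀ ω a n = E := by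
    intro E
    constructor
    · rintro ⟨ψ, h⟩
      obtain ⟨n, hn, rfl, -⟩ := (hiff E ψ).1 h
      exact ⟨n, hn, rfl⟩
    · rintro ⟨n, hn, rfl⟩
      exact ⟨_, isBoundState_waveFun hħ hm₀ hω ha hn one_ne_zero⟩
  refine ⟨hiff, fun m n hm hn => integrable_waveFun_mul hħ hm₀ hω ha hm hn,
    strictMonoOn_energyLevel hħ hm₀ hω ha, fun h => ?_, fun h => ?_⟩
  · -- The largest integer below `r` is `⌈r⌉ - 1`.
    have hpos : 0 < ⌈lam₀ ħ m₀ ω ^ 2 * a ^ 2 - 1 / 2⌉₊ := Nat.ceil_pos.2 (by linarith)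
    have hle : ∀ n : ℕ, n ≤ ⌈lam₀ ħ m₀ ω ^ 2 * a ^ 2 - 1 / 2⌉₊ - 1 ↔
        (n : ℝ) < lam₀ ħ m₀ ω ^ 2 * a ^ 2 - 1 / 2 := fun n => by
      rw [← Nat.lt_ceil]; omega
    refine ⟨⌈lam₀ ħ m₀ ω ^ 2 * a ^ 2 - 1 / 2⌉₊ - 1, ⟨(hle _).1 le_rfl, fun n hn => (hle n).2 hn⟩,
      ?_⟩
    ext E
    simp only [hen, mem_image, mem_Iic, hle]
  · refine eq_empty_of_forall_notMem fun E hE => ?_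
    obtain ⟨n, hn, -⟩ := (hen E).1 hE
    have : (0 : ℝ) ≤ n := n.cast_nonneg
    linarith
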